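/- For $\theta\in\mathbb R$ put $c(\theta)=1+e^{-2\pi i\theta}$ and $v(\theta)=2\cos 2\pi\theta$. For $\Phi,\theta\in\mathbb R$ let $H_{\Phi,\theta}$ be the bounded self-adjoint operator on $\ell^2(\mathbb Z)$ $$(H_{\Phi,\theta}u)_m=c\Big(\theta+m\tfrac{\Phi}{2\pi}\Big)u_{m+1}+\overline{c\Big(\theta+(m-1)\tfrac{\Phi}{2\pi}\Big)}\,u_{m-1}+v\Big(\theta+m\tfrac{\Phi}{2\pi}\Big)u_m ,$$ and let $\Sigma_\Phi=\bigcup_{\theta}\sigma(H_{\Phi,\theta})\subset\mathbb R$. Suppose $\frac{\Phi}{2\pi}=\frac pq$ with $p\in\mathbb Z$, $q\ge 1$ and $\gcd(p,q)=1$. For real $\theta,k$ let $E_1(\theta,k)\le\dots\le E_q(\theta,k)$ be the eigenvalues, with multiplicity, of the Floquet fibre of $H_{\Phi,\theta}$, that is, of the operator $$(hw)_m=e^{ik}c\big(\theta+m\tfrac pq\big)w_{m+1}+e^{-ik}\overline{c\big(\theta+(m-1)\tfrac pq\big)}\,w_{m-1}+v\big(\theta+m\tfrac pq\big)w_m$$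 on the $q$-dimensional space of $q$-periodic sequences $w$, and let the $j$-th band be $B_j=\{E_j(\theta,k):\theta,k\in\mathbb R\}$. Then $\Sigma_\Phi$ is a union of $q$ (possibly touching) bands, that is, there are reals $a_j<b_j$ $(1\le j\le q)$ with $b_i\le a_j$ whenever $i<j$, such that $B_j=[a_j,b_j]$ for each $j$ and $$\Sigma_\Phi=\bigcup_{j=1}^q[a_j,b_j].$$ Moreover the Lebesgue measure of $\Sigma_\Phi$ satisfies $|\Sigma_\Phi|<\dfrac{16\pi}{3q}$. -/

import Mathlib

namespace HexJacobi

/-- The Hilbert space `ℓ²(ℤ)` of complex sequences. -/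
abbrev ellTwo : Type := lp (fun _ : ℤ => ℂ) 2

/-- The off-diagonal sampling function `c(θ) = 1 + e^{-2πiθ}`. -/
noncomputable def c (θ : ℝ) : ℂ := 1 + Complex.exp (-2 * Real.pi * Complex.I * θ)

/-- The diagonal sampling function `v(θ) = 2 cos 2πθ`. -/
noncomputable def v (θ : ℝ) : ℝ := 2 * Real.cos (2 * Real.pi * θ)

theorem norm_c_le (θ : ℝ) : ‖c θ‖ ≤ 2 := by
  have h : ‖Complex.exp (-2 * Real.pi * Complex.I * θ)‖ = 1 := by
    have := Complex.norm_exp_ofReal_mul_I (-2 * Real.pi * θ)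
    rw [← this]
    congr 2
    push_cast
    ring
  calc ‖c θ‖ ≤ ‖(1 : ℂ)‖ + ‖Complex.exp (-2 * Real.pi * Complex.I * θ)‖ := norm_add_le _ _
    _ = 2 := by rw [h, norm_one]; norm_num

theorem norm_v_le (θ : ℝ) : ‖((v θ : ℝ) : ℂ)‖ ≤ 2 := by
  rw [Complex.norm_real, Real.norm_eq_abs, v, abs_mul]
  have := Real.abs_cos_le_one (2 * Real.pi * θ)
  rw [abs_of_pos (by norm_num : (0 : ℝ) < 2)]
  linarith

theorem summable_sq (u : ellTwo) : Summable fun m : ℤ => ‖u m‖ ^ (2 : ℝ) := by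
  simpa using (lp.memℓp u).summable (by norm_num)

theorem summable_sq_shift (u : ellTwo) (k : ℤ) :
    Summable fun m : ℤ => ‖u (m + k)‖ ^ (2 : ℝ) :=
  (summable_sq u).comp_injective (add_left_injective k)

theorem weight_bound {a : ℤ → ℂ} (ha : ∀ m, ‖a m‖ ≤ 2) (k : ℤ) (u : ellTwo) (m : ℤ) :
    ‖a m * u (m + k)‖ ^ (2 : ℝ) ≤ 2 ^ (2 : ℝ) * ‖u (m + k)‖ ^ (2 : ℝ) := by
  rw [norm_mul, Real.mul_rpow (norm_nonneg _) (norm_nonneg _)]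
  have := ha m
  gcongr

theorem memℓp_weightedShift {a : ℤ → ℂ} (ha : ∀ m, ‖a m‖ ≤ 2) (k : ℤ) (u : ellTwo) :
    Memℓp (fun m : ℤ => a m * u (m + k)) 2 := by
  apply memℓp_gen
  simp only [ENNReal.toReal_ofNat]
  exact Summable.of_nonneg_of_le (fun m => by positivity) (weight_bound ha k u)
    ((summable_sq_shift u k).mul_left _)

/-- The bounded operator `(T u)_m = a_m u_{m+k}` on `ℓ²(ℤ)`, for weights with `|a_m| ≤ 2`. -/
noncomputable def weightedShift (a : ℤ → ℂ) (ha : ∀ m, ‖a m‖ ≤ 2) (k : ℤ) :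
    ellTwo →L[ℂ] ellTwo :=
  LinearMap.mkContinuous
    { toFun := fun u => ⟨fun m : ℤ => a m * u (m + k), memℓp_weightedShift ha k u⟩
      map_add' := fun u w => by
        ext m
        exact mul_add _ _ _
      map_smul' := fun z u => by
        ext m
        exact mul_left_comm _ _ _ }
    2
    (fun u => by
      apply lp.norm_le_of_forall_sum_le (p := 2) (by norm_num) (by positivity)
      intro s
      simp only [ENNReal.toReal_ofNat]
      calc ∑ m ∈ s, ‖a m * u (m + k)‖ ^ (2 : ℝ)
          ≤ ∑ m ∈ s, 2 ^ (2 : ℝ) * ‖u (m + k)‖ ^ (2 : ℝ) :=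
            Finset.sum_le_sum fun m _ => weight_bound ha k u m
        _ = 2 ^ (2 : ℝ) * ∑ m ∈ s, ‖u (m + k)‖ ^ (2 : ℝ) := by rw [Finset.mul_sum]
        _ ≤ 2 ^ (2 : ℝ) * ∑' m : ℤ, ‖u (m + k)‖ ^ (2 : ℝ) := by
            gcongr
            exact (summable_sq_shift u k).sum_le_tsum s (fun m _ => by positivity)
        _ = 2 ^ (2 : ℝ) * ∑' m : ℤ, ‖u m‖ ^ (2 : ℝ) := by
            congr 1
            exact (Equiv.addRight k).tsum_eq (fun m : ℤ => ‖u m‖ ^ (2 : ℝ))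
        _ = (2 * ‖u‖) ^ (2 : ℝ) := by
            rw [Real.mul_rpow (by norm_num) (norm_nonneg _)]
            congr 1
            have := lp.norm_rpow_eq_tsum (p := 2) (by norm_num) u
            simpa using this.symm)

/-- The quasi-periodic Jacobi operator
`(H u)_m = c(θ + mΦ/2π) u_{m+1} + conj(c(θ + (m-1)Φ/2π)) u_{m-1} + v(θ + mΦ/2π) u_m`
on `ℓ²(ℤ)`; the displayed formula is `H_apply`. -/
noncomputable def H (Φ θ : ℝ) : ellTwo →L[ℂ] ellTwo :=
  weightedShift (fun m => c (θ + m * (Φ / (2 * Real.pi)))) (fun _ => norm_c_le _) 1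
  + weightedShift (fun m => (starRingEnd ℂ) (c (θ + (m - 1) * (Φ / (2 * Real.pi)))))
      (fun _ => by rw [RCLike.norm_conj]; exact norm_c_le _) (-1)
  + weightedShift (fun m => (v (θ + m * (Φ / (2 * Real.pi))) : ℂ)) (fun _ => norm_v_le _) 0

theorem H_apply (Φ θ : ℝ) (u : ellTwo) (m : ℤ) :
    H Φ θ u m = c (θ + m * (Φ / (2 * Real.pi))) * u (m + 1)
      + (starRingEnd ℂ) (c (θ + (m - 1) * (Φ / (2 * Real.pi)))) * u (m - 1)
      + (v (θ + m * (Φ / (2 * Real.pi))) : ℂ) * u m := by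
  have h : (v (θ + m * (Φ / (2 * Real.pi))) : ℂ) * u m
      = (v (θ + m * (Φ / (2 * Real.pi))) : ℂ) * u (m + 0) := by rw [add_zero]
  rw [h]
  rfl

/-- `H Φ θ` is self-adjoint, so that its spectrum is a set of real numbers. -/
theorem isSelfAdjoint_H (Φ θ : ℝ) : IsSelfAdjoint (H Φ θ) := by
  rw [ContinuousLinearMap.isSelfAdjoint_iff_isSymmetric]
  intro u w
  have key : ∀ x y : ellTwo, HasSum (fun m : ℤ => (starRingEnd ℂ) (x m) * y m) (inner ℂ x y) := by
    intro x y
    have := lp.hasSum_inner (𝕜 := ℂ) x y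
    simpa [RCLike.inner_apply, mul_comm] using this
  -- the three pieces of the quadratic form
  set C : ℤ → ℂ := fun m => c (θ + m * (Φ / (2 * Real.pi))) with hC
  set V : ℤ → ℝ := fun m => v (θ + m * (Φ / (2 * Real.pi))) with hV
  have hC' : ∀ m : ℤ, c (θ + (m - 1) * (Φ / (2 * Real.pi))) = C (m - 1) := by
    intro m; simp [hC]
  set A := weightedShift C (fun _ => norm_c_le _) 1
  set B := weightedShift (fun m => (starRingEnd ℂ) (C (m - 1)))
    (fun _ => by rw [RCLike.norm_conj]; exact norm_c_le _) (-1)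
  set D := weightedShift (fun m => (V m : ℂ)) (fun _ => norm_v_le _) 0
  have hH : H Φ θ = A + B + D := by
    ext x m
    simp only [H_apply, hC']
    have h : (V m : ℂ) * x m = (V m : ℂ) * x (m + 0) := by rw [add_zero]
    change C m * x (m + 1) + (starRingEnd ℂ) (C (m - 1)) * x (m - 1) + (V m : ℂ) * x m = _
    rw [h]
    rfl
  have hAB : ∀ x y : ellTwo, inner ℂ (A x) y = inner ℂ x (B y) := by
    intro x y
    have h1 := key (A x) y
    have h2 := (Equiv.addRight (1 : ℤ)).hasSum_iff.mpr (key x (B y))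
    refine h1.unique ?_
    convert h2 using 1
    funext m
    change (starRingEnd ℂ) (C m * x (m + 1)) * y m
      = (starRingEnd ℂ) (x (m + 1)) * ((starRingEnd ℂ) (C (m + 1 - 1)) * y (m + 1 + -1))
    rw [add_sub_cancel_right, add_neg_cancel_right, map_mul]
    ring
  have hBA : ∀ x y : ellTwo, inner ℂ (B x) y = inner ℂ x (A y) := by
    intro x y
    rw [← inner_conj_symm, ← hAB, inner_conj_symm]
  have hDD : ∀ x y : ellTwo, inner ℂ (D x) y = inner ℂ x (D y) := by
    intro x y
    refine (key (D x) y).unique ?_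
    convert key x (D y) using 1
    funext m
    change (starRingEnd ℂ) ((V m : ℂ) * x (m + 0)) * y m
      = (starRingEnd ℂ) (x m) * ((V m : ℂ) * y (m + 0))
    rw [add_zero, map_mul, Complex.conj_ofReal]
    ring
  rw [hH]
  change inner ℂ (A u + B u + D u) w = inner ℂ u (A w + B w + D w)
  rw [inner_add_left, inner_add_left, inner_add_right, inner_add_right, hAB, hBA, hDD]
  ring

/-- `Σ_Φ = ⋃_θ σ(H_{Φ,θ})`. The sampling functions have period `1`, so the union over real `θ`
is the union over the circle `ℝ/ℤ`. -/
noncomputable def spec (Φ : ℝ) : Set ℝ := ⋃ θ : ℝ, spectrum ℝ (H Φ θ)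

/-- For `Φ/2π = p/q`, the Floquet fibre of `H Φ θ` at quasi-momentum `k`: the matrix of
`(h w)_m = e^{ik} c(θ + mΦ/2π) w_{m+1} + e^{-ik} conj(c(θ + (m-1)Φ/2π)) w_{m-1} + v(θ + mΦ/2π) w_m`
on sequences `w` of period `q`, with respect to the values `w_0, …, w_{q-1}`. -/
noncomputable def floquet (Φ : ℝ) (q : ℕ) (θ k : ℝ) : Matrix (Fin q) (Fin q) ℂ :=
  Matrix.of fun i j =>
    (if ((i : ℕ) + 1) % q = j then
      Complex.exp (Complex.I * k) * c (θ + (i : ℕ) * (Φ / (2 * Real.pi))) else 0)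
    + (if ((j : ℕ) + 1) % q = i then
      Complex.exp (-(Complex.I * k)) * (starRingEnd ℂ) (c (θ + (j : ℕ) * (Φ / (2 * Real.pi))))
      else 0)
    + (if i = j then (v (θ + (i : ℕ) * (Φ / (2 * Real.pi))) : ℂ) else 0)

theorem floquet_isHermitian (Φ : ℝ) (q : ℕ) (θ k : ℝ) : (floquet Φ q θ k).IsHermitian := by
  have hexp : (starRingEnd ℂ) (Complex.exp (Complex.I * k)) = Complex.exp (-(Complex.I * k)) := by
    rw [← Complex.exp_conj]
    simp
  have hexp' : (starRingEnd ℂ) (Complex.exp (-(Complex.I * k))) = Complex.exp (Complex.I * k) := by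
    rw [← hexp, Complex.conj_conj]
  apply Matrix.IsHermitian.ext
  intro i j
  simp only [floquet, Matrix.of_apply, RCLike.star_def, map_add]
  have h3 : (starRingEnd ℂ) (if j = i then (v (θ + (j : ℕ) * (Φ / (2 * Real.pi))) : ℂ) else 0)
      = if i = j then (v (θ + (i : ℕ) * (Φ / (2 * Real.pi))) : ℂ) else 0 := by
    by_cases h : i = j
    · subst h; simp
    · simp [h, Ne.symm h]
  rw [h3, add_comm ((starRingEnd ℂ) (if ((j : ℕ) + 1) % q = i then _ else _))]
  congr 2
  · split_ifs <;> simp [hexp']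
  · split_ifs <;> simp [hexp]

/-- The band function: the `j`-th smallest eigenvalue, with multiplicity, of the Floquet fibre
(Mathlib's `eigenvalues₀` lists the eigenvalues in decreasing order). -/
noncomputable def bandFunction (Φ : ℝ) (q : ℕ) (j : Fin q) (θ k : ℝ) : ℝ :=
  (floquet_isHermitian Φ q θ k).eigenvalues₀ (Fin.cast (Fintype.card_fin q).symm j.rev)

/-- The `j`-th band: the set of all values of the `j`-th band function. -/
noncomputable def band (Φ : ℝ) (q : ℕ) (j : Fin q) : Set ℝ :=
  {x | ∃ θ k : ℝ, bandFunction Φ q j θ k = x}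

end HexJacobi

/-!
Write `ω = e^{-2πip/q}`, `z = e^{-2πiθ}`, `y = e^{ik}`. In terms of the clock matrix `W` and the
cyclic shift `S`, which satisfy `S W = ω W S`, the Floquet fibre is
`y (1 + z W) S + y⁻¹ Sᵀ (1 + z⁻¹ W⁻¹) + z W + z⁻¹ W⁻¹`.

*Chambers' formula.* The characteristic polynomial of the fibre is a fixed polynomial `P` minus the
scalar `g(θ, k) = 2 cos qk + 2 cos 2πqθ - (-1)^q 2 cos (qk - 2πqθ)` (`charpoly_fibreMatrix`,
`charpoly_floquet`). Conjugation by `W` multiplies `y` by a primitive `q`-th root of unity, so as a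
Laurent polynomial in `y` the determinant has only terms of degree `-q`, `0`, `q`, the outer two
being determinants of the coefficient matrices; conjugation by `S` does the same for `z`
(`det_quadratic_pencil`). Hence `det (E - h) + g` depends neither on `k` nor on `θ`
(`det_add_chambersTerm_eq`). In particular a band function depends on `(θ, k)` through `g` only.

*The spectrum is the union of the bands* (`spec_eq_iUnion_band`). Truncated Bloch waves show that
every value of a band function is in the spectrum (`bandFunction_mem_spectrum`). Conversely, the
Cayley–Hamilton theorem in the fibres gives `P(H) = α T + ᾱ T⁻¹ + β` with `T` the translation by `q`
sites (`aeval_H`), so that a point `x` of the spectrum has `|P(x) - β| ≤ 2 |α|`; this says that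
`P(x) = g(θ, k)` for some `k` (`spectrum_H_subset`).

*The bands are intervals with disjoint interiors.* Band functions are continuous on the plane
and, being functions of `g`, doubly periodic, so the bands are compact intervals. If two bands
overlapped in an open interval, the intermediate value theorem would make each of its points a
double root of some `P - g(θ, k)`, hence a root of `P'` (`bandFunction_le_of_lt`).

*The measure* (`volume_spec_lt`). After a diagonal gauge transformation `k` occurs only in the edge
that closes the cycle, of weight `c₀ = c(θ + (q-1)p/q)`. The fibres at `θ` thus lie between
`A - |c₀| K` and `A + |c₀| K` in the Loewner order, where `A` is the fibre with that edge removed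
and `K` the sum of the coordinate projections at its two endpoints; by Weyl's monotonicity
principle the values of all band functions at `θ` lie in intervals of total length
`|c₀| tr 2K = 4 |c₀|` (`exists_Icc_bandFunction`). The range of `(-1)^q g` is contained in
`[-6, 3] = [-6, 2] ∪ [-1, 3]`, and the two parts are attained on two phases for which
`|c₀| < π / q` and `|c₀| < π / (3q)`.
-/

namespace HexJacobi

open Matrix Polynomial

/-! ### Determinants of matrix pencils with a root-of-unity symmetry -/

section Pencil

/-- A polynomial invariant under `y ↦ ω y` is a polynomial in `y ^ q`. -/
theorem coeff_eq_zero_of_eval_mul_eq {p : ℂ[X]} {q : ℕ} {ω : ℂ} (hω : IsPrimitiveRoot ω q)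
    (h : ∀ y, p.eval (ω * y) = p.eval y) {m : ℕ} (hm : ¬ q ∣ m) : p.coeff m = 0 := by
  have hp : p.comp (C ω * X) = p := by
    apply Polynomial.funext
    intro y
    simpa [eval_comp] using h y
  have h1 := congrArg (fun r => r.coeff m) hp
  simp only [comp_C_mul_X_coeff] at h1
  have h2 : ω ^ m ≠ 1 := fun h' => hm ((hω.pow_eq_one_iff_dvd m).mp h')
  have h3 : p.coeff m * (ω ^ m - 1) = 0 := by rw [mul_sub, h1]; ring
  exact (mul_eq_zero.mp h3).resolve_right (sub_ne_zero.mpr h2)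

theorem natDegree_quadratic_entry {n : Type*} (A B D : Matrix n n ℂ) (i j : n) :
    (((X : ℂ[X]) ^ 2 • A.map C + (X : ℂ[X]) • B.map C + D.map C : Matrix n n ℂ[X]) i j).natDegree
      ≤ 2 := by
  dsimp only [Matrix.add_apply, Matrix.smul_apply, map_apply, smul_eq_mul]
  compute_degree

variable {n : Type*} [DecidableEq n] [Fintype n]

/-- If conjugation by `V` multiplies `A` by `ω` and fixes `B`, then `det (y A + B)` is invariant
under `y ↦ ω y`, so only its extreme coefficients survive. -/
theorem det_linear_pencil {ω : ℂ} (hω : IsPrimitiveRoot ω (Fintype.card n))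
    (hn : 0 < Fintype.card n) {A B V : Matrix n n ℂ} (hV : V.det ≠ 0)
    (hA : V * A = ω • (A * V)) (hB : V * B = B * V) (y : ℂ) :
    (y • A + B).det = A.det * y ^ Fintype.card n + B.det := by
  set p : ℂ[X] := det ((X : ℂ[X]) • A.map C + B.map C) with hp
  have heval : ∀ y, p.eval y = (y • A + B).det := by
    intro y
    rw [hp, ← coe_evalRingHom, RingHom.map_det]
    congr 1
    ext i j
    simp only [coe_evalRingHom, RingHom.mapMatrix_apply, map_apply, Matrix.add_apply,
      Matrix.smul_apply, smul_eq_mul, eval_add, eval_mul, eval_X, eval_C]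
  have hinv : ∀ y, p.eval (ω * y) = p.eval y := by
    intro y
    rw [heval, heval]
    have h1 : V * (y • A + B) = ((ω * y) • A + B) * V := by
      rw [mul_add, add_mul, Matrix.mul_smul, hA, hB, Matrix.smul_mul, smul_smul, mul_comm y]
    have h2 := congrArg det h1
    rw [det_mul, det_mul, mul_comm] at h2
    exact (mul_right_cancel₀ hV h2).symm
  have hpe : p = C A.det * X ^ Fintype.card n + C B.det := by
    ext m
    simp only [coeff_add, coeff_C_mul, coeff_X_pow, coeff_C]
    by_cases hm0 : m = 0
    · subst hm0
      rw [hp, coeff_det_X_add_C_zero]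
      simp [hn.ne]
    by_cases hmn : m = Fintype.card n
    · subst hmn
      rw [hp, coeff_det_X_add_C_card]
      simp [hn.ne']
    rw [if_neg hmn, if_neg hm0]
    simp only [mul_zero, add_zero]
    by_cases hle : m ≤ Fintype.card n
    · apply coeff_eq_zero_of_eval_mul_eq hω hinv
      rintro ⟨k, rfl⟩
      have : k ≤ 1 := by
        by_contra hk
        push Not at hk
        nlinarith
      interval_cases k <;> simp_all
    · exact coeff_eq_zero_of_natDegree_lt
        ((natDegree_det_X_add_C_le A B).trans_lt (not_le.mp hle))
  rw [← heval, hpe]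
  simp

theorem natDegree_det_quadratic_le (A B D : Matrix n n ℂ) :
    (det ((X : ℂ[X]) ^ 2 • A.map C + (X : ℂ[X]) • B.map C + D.map C)).natDegree
      ≤ Fintype.card n * 2 := by
  rw [det_apply']
  refine natDegree_sum_le_of_forall_le _ _ fun g _ => ?_
  rw [← Polynomial.C_eq_intCast]
  refine (natDegree_C_mul_le _ _).trans ((natDegree_prod_le _ _).trans ?_)
  refine (Finset.sum_le_card_nsmul _ _ 2 fun i _ => natDegree_quadratic_entry A B D _ _).trans ?_
  simp [Finset.card_univ]

theorem coeff_det_quadratic_top (A B D : Matrix n n ℂ) :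
    (det ((X : ℂ[X]) ^ 2 • A.map C + (X : ℂ[X]) • B.map C + D.map C)).coeff (Fintype.card n * 2)
      = A.det := by
  rw [det_apply', det_apply', finsetSum_coeff]
  refine Finset.sum_congr rfl fun g _ => ?_
  rw [← Polynomial.C_eq_intCast, coeff_C_mul]
  congr 1
  rw [Fintype.card, coeff_prod_of_natDegree_le _ _ _
    fun i _ => natDegree_quadratic_entry A B D _ _]
  refine Finset.prod_congr rfl fun i _ => ?_
  simp

/-- If conjugation by `V` multiplies `A` by `ω`, fixes `B` and multiplies `D` by `ω⁻¹`, then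
`det (y A + B + y⁻¹ D)` is invariant under `y ↦ ω y`, so only the coefficients of degree
`q`, `0`, `-q` survive. -/
theorem det_quadratic_pencil {ω : ℂ} (hω : IsPrimitiveRoot ω (Fintype.card n))
    (hn : 0 < Fintype.card n) {A B D V : Matrix n n ℂ} (hV : V.det ≠ 0)
    (hA : V * A = ω • (A * V)) (hB : V * B = B * V) (hD : ω • (V * D) = D * V) :
    ∃ d : ℂ, ∀ y : ℂ, y ≠ 0 → (y • A + B + y⁻¹ • D).det
      = A.det * y ^ Fintype.card n + d + D.det * (y⁻¹) ^ Fintype.card n := by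
  set N := Fintype.card n with hN
  set p : ℂ[X] := det ((X : ℂ[X]) ^ 2 • A.map C + (X : ℂ[X]) • B.map C + D.map C) with hp
  have heval : ∀ y, p.eval y = (y ^ 2 • A + y • B + D).det := by
    intro y
    rw [hp, ← coe_evalRingHom, RingHom.map_det]
    congr 1
    ext i j
    simp only [coe_evalRingHom, RingHom.mapMatrix_apply, map_apply, Matrix.add_apply,
      Matrix.smul_apply, smul_eq_mul, eval_add, eval_mul, eval_pow, eval_X, eval_C]
  have hω1 : ω ^ N = 1 := hω.pow_eq_one
  have hinv : ∀ y, p.eval (ω * y) = p.eval y := by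
    intro y
    rw [heval, heval]
    have h1 : ω • (V * (y ^ 2 • A + y • B + D)) = ((ω * y) ^ 2 • A + (ω * y) • B + D) * V := by
      simp only [mul_add, add_mul, Matrix.mul_smul, Matrix.smul_mul, smul_add, hA, hB, hD,
        smul_smul]
      congr 3
      ring
    have h2 := congrArg det h1
    rw [det_smul, ← hN, hω1, one_mul, det_mul, det_mul, mul_comm] at h2
    exact (mul_right_cancel₀ hV h2).symm
  obtain ⟨d, hd⟩ : ∃ d, d = p.coeff N := ⟨_, rfl⟩
  have hpe : p = C A.det * X ^ (N * 2) + C d * X ^ N + C D.det := by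
    ext m
    simp only [coeff_add, coeff_C_mul, coeff_X_pow, coeff_C]
    by_cases hm0 : m = 0
    · subst hm0
      have h0 := heval 0
      rw [← coeff_zero_eq_eval_zero] at h0
      rw [h0]
      simp [hn.ne, hn.ne']
    by_cases hmn : m = N
    · subst hmn
      simp [hn.ne', hd]
    by_cases hm2 : m = N * 2
    · subst hm2
      rw [hp, coeff_det_quadratic_top]
      simp [hn.ne']
    rw [if_neg hmn, if_neg hm0, if_neg hm2]
    simp only [mul_zero, add_zero]
    by_cases hle : m ≤ N * 2
    · apply coeff_eq_zero_of_eval_mul_eq hω hinv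
      rintro ⟨k, rfl⟩
      have : k ≤ 2 := by
        by_contra hk
        push Not at hk
        nlinarith
      interval_cases k <;> simp_all
    · exact coeff_eq_zero_of_natDegree_lt
        ((natDegree_det_quadratic_le A B D).trans_lt (not_le.mp hle))
  refine ⟨d, fun y hy => ?_⟩
  have h1 : y • A + B + y⁻¹ • D = y⁻¹ • (y ^ 2 • A + y • B + D) := by
    simp only [smul_add, smul_smul]
    rw [inv_mul_cancel₀ hy, one_smul]
    congr 3
    field_simp
  rw [h1, det_smul, ← heval, hpe]
  simp only [eval_add, eval_mul, eval_C, eval_pow, eval_X, inv_pow, ← hN]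
  field_simp
  ring

end Pencil

/-! ### Clock and shift matrices and Chambers' formula -/

/-- The clock matrix `diag(1, ω, …, ω^{q-1})`. -/
noncomputable def clockMatrix (q : ℕ) (ω : ℂ) : Matrix (Fin q) (Fin q) ℂ :=
  diagonal fun i => ω ^ (i : ℕ)

/-- The cyclic shift `(S w)_i = w_{i+1}` on sequences of period `q`. -/
def shiftMatrix (q : ℕ) [NeZero q] : Matrix (Fin q) (Fin q) ℂ :=
  of fun i j => if i + 1 = j then 1 else 0

section ClockShift

variable {q : ℕ} [NeZero q] {ω : ℂ}

theorem pow_val_add_one (hω : ω ^ q = 1) (i : Fin q) :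
    ω ^ ((i + 1 : Fin q) : ℕ) = ω * ω ^ (i : ℕ) := by
  rw [← pow_succ', Fin.val_add, Fin.val_one', Nat.add_mod_mod, ← pow_eq_pow_mod _ hω]

theorem shiftMatrix_mul_transpose : shiftMatrix q * (shiftMatrix q)ᵀ = 1 := by
  ext i j
  simp [shiftMatrix, mul_apply, Matrix.one_apply, eq_comm]

theorem shiftMatrix_mul_clockMatrix (hω : ω ^ q = 1) :
    shiftMatrix q * clockMatrix q ω = ω • (clockMatrix q ω * shiftMatrix q) := by
  ext i j
  simp only [shiftMatrix, clockMatrix, mul_diagonal, diagonal_mul, Matrix.smul_apply, of_apply,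
    smul_eq_mul]
  split_ifs with h
  · rw [← h, pow_val_add_one hω]; ring
  · simp

theorem clockMatrix_mul_transpose (hω : ω ^ q = 1) :
    clockMatrix q ω * (shiftMatrix q)ᵀ = ω • ((shiftMatrix q)ᵀ * clockMatrix q ω) := by
  have h := congrArg transpose (shiftMatrix_mul_clockMatrix (q := q) hω)
  simpa [transpose_mul, clockMatrix] using h

/-- The value follows from `det (1 - W) = 0`, since `det (1 + y W) = 1 + y ^ q det W`. -/
theorem det_clockMatrix (hω : IsPrimitiveRoot ω q) : (clockMatrix q ω).det = -(-1) ^ q := by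
  have hq := Nat.pos_of_neZero q
  have hS : (shiftMatrix q).det ≠ 0 := by
    intro h
    have := congrArg det (shiftMatrix_mul_transpose (q := q))
    simp [det_mul, h] at this
  have hcard := Fintype.card_fin q
  have h := det_linear_pencil (A := clockMatrix q ω) (B := 1) (V := shiftMatrix q)
    (hcard.symm ▸ hω) (hcard.symm ▸ hq) hS (shiftMatrix_mul_clockMatrix hω.pow_eq_one)
    (by simp) (-1)
  have h0 : ((-1 : ℂ) • clockMatrix q ω + 1).det = 0 := by
    have : ((-1 : ℂ) • clockMatrix q ω + 1)
        = diagonal fun i : Fin q => 1 - ω ^ (i : ℕ) := by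
      rw [clockMatrix, ← diagonal_one, ← diagonal_smul, diagonal_add]
      congr 1
      ext i
      simp
      ring
    rw [this, det_diagonal]
    exact Finset.prod_eq_zero (Finset.mem_univ (0 : Fin q)) (by simp)
  rw [h0, hcard, det_one] at h
  have h2 : ((-1 : ℂ) ^ q) * (-1) ^ q = 1 := by rw [← mul_pow]; simp
  linear_combination (-1 : ℂ) ^ q * (-h) + (-(clockMatrix q ω).det) * h2

theorem det_clockMatrix_ne_zero (hω : IsPrimitiveRoot ω q) : (clockMatrix q ω).det ≠ 0 := by
  rw [det_clockMatrix hω]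
  simp

theorem clockMatrix_mul_shiftMatrix (hω : ω ^ q = 1) (hω0 : ω ≠ 0) :
    clockMatrix q ω * shiftMatrix q = ω⁻¹ • (shiftMatrix q * clockMatrix q ω) := by
  rw [shiftMatrix_mul_clockMatrix hω, smul_smul, inv_mul_cancel₀ hω0, one_smul]

theorem det_smul_shiftMatrix_add_one (hω : IsPrimitiveRoot ω q) (y : ℂ) :
    (y • shiftMatrix q + 1).det = (shiftMatrix q).det * y ^ q + 1 := by
  have hq := Nat.pos_of_neZero q
  have hcard := Fintype.card_fin q
  have h := det_linear_pencil (A := shiftMatrix q) (B := 1) (V := clockMatrix q ω)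
    (hcard.symm ▸ hω.inv) (hcard.symm ▸ hq) (det_clockMatrix_ne_zero hω)
    (clockMatrix_mul_shiftMatrix hω.pow_eq_one (hω.ne_zero hq.ne')) (by simp) y
  simpa using h

/-- The value follows from `det (1 - S) = 0`, since `det (1 + y S) = 1 + y ^ q det S`. -/
theorem det_shiftMatrix : (shiftMatrix q).det = -(-1) ^ q := by
  have hq := Nat.pos_of_neZero q
  have h := det_smul_shiftMatrix_add_one (Complex.isPrimitiveRoot_exp q hq.ne') (-1)
  have h0 : ((-1 : ℂ) • shiftMatrix q + 1).det = 0 := by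
    rw [← exists_mulVec_eq_zero_iff]
    refine ⟨fun _ => 1, fun h => one_ne_zero (congrFun h 0), ?_⟩
    ext i
    simp [shiftMatrix, mulVec, dotProduct, Matrix.one_apply, Finset.sum_add_distrib]
  rw [h0] at h
  have h2 : ((-1 : ℂ) ^ q) * (-1) ^ q = 1 := by rw [← mul_pow]; simp
  linear_combination (-1 : ℂ) ^ q * (-h) + (-(shiftMatrix q).det) * h2

theorem det_one_add_shiftMatrix (y : ℂ) :
    (1 + y • shiftMatrix q).det = 1 - (-y) ^ q := by
  rw [add_comm, det_smul_shiftMatrix_add_one (Complex.isPrimitiveRoot_exp q (NeZero.ne q)),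
    det_shiftMatrix, neg_pow y]
  ring

theorem det_one_add_clockMatrix (hω : IsPrimitiveRoot ω q) (z : ℂ) :
    (1 + z • clockMatrix q ω).det = 1 - (-z) ^ q := by
  have hq := Nat.pos_of_neZero q
  have hcard := Fintype.card_fin q
  have hS : (shiftMatrix q).det ≠ 0 := by rw [det_shiftMatrix]; simp
  have h := det_linear_pencil (A := clockMatrix q ω) (B := 1) (V := shiftMatrix q)
    (hcard.symm ▸ hω) (hcard.symm ▸ hq) hS (shiftMatrix_mul_clockMatrix hω.pow_eq_one)
    (by simp) z
  rw [add_comm, h, det_clockMatrix hω, neg_pow z, hcard, det_one]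
  ring

/-- The Floquet fibre as a Laurent polynomial in `y = e^{ik}` and `z = e^{-2πiθ}`, for arbitrary
complex `y` and `z`. -/
noncomputable def fibreMatrix (q : ℕ) [NeZero q] (ω y z : ℂ) : Matrix (Fin q) (Fin q) ℂ :=
  y • ((1 + z • clockMatrix q ω) * shiftMatrix q)
    + y⁻¹ • ((shiftMatrix q)ᵀ * (1 + z⁻¹ • clockMatrix q ω⁻¹))
    + (z • clockMatrix q ω + z⁻¹ • clockMatrix q ω⁻¹)

/-- The part of the characteristic polynomial of `fibreMatrix` that depends on `y` and `z`, up to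
sign. -/
noncomputable def chambersTerm (q : ℕ) (y z : ℂ) : ℂ :=
  (1 - (-z) ^ q) * y ^ q + (1 - (-z⁻¹) ^ q) * y⁻¹ ^ q + (z ^ q + z⁻¹ ^ q)

/-- The dependence of the characteristic polynomial on `y`: conjugation by the clock matrix is a
rotation of `y`. -/
theorem exists_det_eq_sub_of_quasimomentum (hω : IsPrimitiveRoot ω q) (E z : ℂ) :
    ∃ d : ℂ, ∀ y : ℂ, y ≠ 0 → (E • (1 : Matrix (Fin q) (Fin q) ℂ) - fibreMatrix q ω y z).det
      = d - chambersTerm q y z := by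
  have hq := Nat.pos_of_neZero q
  have hcard := Fintype.card_fin q
  have hω0 := hω.ne_zero hq.ne'
  set W := clockMatrix q ω with hW
  set W' := clockMatrix q ω⁻¹ with hW'
  set S := shiftMatrix q with hS
  have hWW' : W * W' = W' * W := by simp [hW, hW', clockMatrix, diagonal_mul_diagonal, mul_comm]
  obtain ⟨d, hd⟩ := det_quadratic_pencil (A := -((1 + z • W) * S))
    (B := E • 1 - (z • W + z⁻¹ • W')) (D := -(Sᵀ * (1 + z⁻¹ • W'))) (V := W)
    (hcard.symm ▸ hω.inv) (hcard.symm ▸ hq) (det_clockMatrix_ne_zero hω)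
    (by
      have h1 : W * (1 + z • W) = (1 + z • W) * W := by
        simp [mul_add, add_mul]
      rw [mul_neg, neg_mul, smul_neg, ← mul_assoc, h1, mul_assoc, mul_assoc,
        clockMatrix_mul_shiftMatrix hω.pow_eq_one hω0, Matrix.mul_smul])
    (by simp only [mul_sub, sub_mul, mul_add, add_mul, Matrix.mul_smul, Matrix.smul_mul, mul_one,
          one_mul, hWW'])
    (by
      have h1 : W * (1 + z⁻¹ • W') = (1 + z⁻¹ • W') * W := by
        simp [mul_add, add_mul, hWW']
      rw [mul_neg, neg_mul, smul_neg, ← mul_assoc, clockMatrix_mul_transpose hω.pow_eq_one,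
        Matrix.smul_mul, smul_smul, inv_mul_cancel₀ hω0, one_smul, mul_assoc, mul_assoc, h1])
  refine ⟨d + (z ^ q + z⁻¹ ^ q), fun y hy => ?_⟩
  have h := hd y hy
  have h1 : E • (1 : Matrix (Fin q) (Fin q) ℂ) - fibreMatrix q ω y z
      = y • (-((1 + z • W) * S)) + (E • 1 - (z • W + z⁻¹ • W'))
        + y⁻¹ • (-(Sᵀ * (1 + z⁻¹ • W'))) := by
    rw [fibreMatrix, smul_neg, smul_neg]
    abel
  rw [h1, h, det_neg, det_neg, det_mul, det_mul, det_transpose, det_one_add_clockMatrix hω,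
    det_one_add_clockMatrix hω.inv, det_shiftMatrix, hcard, chambersTerm]
  have h2 : ((-1 : ℂ) ^ q) * (-1) ^ q = 1 := by rw [← mul_pow]; simp
  linear_combination (-(1 - (-z) ^ q) * y ^ q - (1 - (-z⁻¹) ^ q) * y⁻¹ ^ q) * h2

/-- The dependence of the characteristic polynomial on `z`: conjugation by the shift is a rotation
of `z`. -/
theorem exists_det_eq_sub_of_phase (hω : IsPrimitiveRoot ω q) (E y : ℂ) :
    ∃ d : ℂ, ∀ z : ℂ, z ≠ 0 → (E • (1 : Matrix (Fin q) (Fin q) ℂ) - fibreMatrix q ω y z).det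
      = d - chambersTerm q y z := by
  have hq := Nat.pos_of_neZero q
  have hcard := Fintype.card_fin q
  have hω0 := hω.ne_zero hq.ne'
  set W := clockMatrix q ω with hW
  set W' := clockMatrix q ω⁻¹ with hW'
  set S := shiftMatrix q with hS
  have hSS : S * Sᵀ = Sᵀ * S := by
    rw [shiftMatrix_mul_transpose, mul_eq_one_comm.mp shiftMatrix_mul_transpose]
  have hSW : S * W = ω • (W * S) := shiftMatrix_mul_clockMatrix hω.pow_eq_one
  have hSW' : S * W' = ω⁻¹ • (W' * S) := shiftMatrix_mul_clockMatrix hω.inv.pow_eq_one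
  obtain ⟨d, hd⟩ := det_quadratic_pencil (A := -(W * (1 + y • S)))
    (B := E • 1 - (y • S + y⁻¹ • Sᵀ)) (D := -((1 + y⁻¹ • Sᵀ) * W')) (V := S)
    (hcard.symm ▸ hω) (hcard.symm ▸ hq) (by rw [det_shiftMatrix]; simp)
    (by
      have h1 : S * (1 + y • S) = (1 + y • S) * S := by
        simp [mul_add, add_mul]
      rw [mul_neg, neg_mul, smul_neg, ← mul_assoc, hSW, Matrix.smul_mul, mul_assoc, h1, mul_assoc])
    (by simp only [mul_sub, sub_mul, mul_add, add_mul, Matrix.mul_smul, Matrix.smul_mul, mul_one,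
          one_mul, hSS])
    (by
      have h1 : S * (1 + y⁻¹ • Sᵀ) = (1 + y⁻¹ • Sᵀ) * S := by
        simp [mul_add, add_mul, hSS]
      rw [mul_neg, neg_mul, smul_neg, ← mul_assoc, h1, mul_assoc, hSW', Matrix.mul_smul, smul_smul,
        mul_inv_cancel₀ hω0, one_smul, mul_assoc])
  refine ⟨d + (y ^ q + y⁻¹ ^ q), fun z hz => ?_⟩
  have h := hd z hz
  have h1 : E • (1 : Matrix (Fin q) (Fin q) ℂ) - fibreMatrix q ω y z
      = z • (-(W * (1 + y • S))) + (E • 1 - (y • S + y⁻¹ • Sᵀ))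
        + z⁻¹ • (-((1 + y⁻¹ • Sᵀ) * W')) := by
    rw [fibreMatrix]
    simp only [mul_add, add_mul, mul_one, one_mul, Matrix.mul_smul, Matrix.smul_mul, smul_neg,
      smul_add, smul_smul, ← hW, ← hW', ← hS]
    rw [mul_comm z y, mul_comm z⁻¹ y⁻¹]
    abel
  have h3 : (1 + y⁻¹ • Sᵀ).det = 1 - (-y⁻¹) ^ q := by
    rw [← det_one_add_shiftMatrix, ← det_transpose]
    simp [hS]
  rw [h1, h, det_neg, det_neg, det_mul, det_mul, h3, det_one_add_shiftMatrix,
    det_clockMatrix hω, det_clockMatrix hω.inv, hcard, chambersTerm]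
  have h2 : ((-1 : ℂ) ^ q) * (-1) ^ q = 1 := by rw [← mul_pow]; simp
  have e1 := neg_pow y q
  have e2 := neg_pow y⁻¹ q
  have e3 := neg_pow z q
  have e4 := neg_pow z⁻¹ q
  rw [e1, e2, e3, e4]
  linear_combination (-(1 - (-1) ^ q * y ^ q) * z ^ q - (1 - (-1) ^ q * y⁻¹ ^ q) * z⁻¹ ^ q) * h2

/-- Chambers' formula: `det (E - h) + g` depends neither on `y` nor on `z`. -/
theorem det_add_chambersTerm_eq (hω : IsPrimitiveRoot ω q) (E : ℂ) {y z y' z' : ℂ}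
    (hy : y ≠ 0) (hz : z ≠ 0) (hy' : y' ≠ 0) (hz' : z' ≠ 0) :
    (E • (1 : Matrix (Fin q) (Fin q) ℂ) - fibreMatrix q ω y z).det + chambersTerm q y z
      = (E • (1 : Matrix (Fin q) (Fin q) ℂ) - fibreMatrix q ω y' z').det
        + chambersTerm q y' z' := by
  obtain ⟨d, hd⟩ := exists_det_eq_sub_of_quasimomentum hω E z
  obtain ⟨d', hd'⟩ := exists_det_eq_sub_of_phase hω E y'
  have h1 := hd y hy
  have h2 := hd y' hy'
  have h3 := hd' z hz
  have h4 := hd' z' hz'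
  rw [h1, h4]
  linear_combination h3 - h2

end ClockShift

/-! ### Ordered eigenvalues of Hermitian matrices -/

section Eigenvalues

theorem re_inner_apply_self_eq_sum {E : Type*} [NormedAddCommGroup E] [InnerProductSpace ℂ E]
    [FiniteDimensional ℂ E] {d : ℕ} (hd : Module.finrank ℂ E = d) {T : E →ₗ[ℂ] E}
    (hT : T.IsSymmetric) (x : E) :
    (inner ℂ x (T x)).re
      = ∑ j, hT.eigenvalues hd j * ‖inner ℂ (hT.eigenvectorBasis hd j) x‖ ^ 2 := by
  rw [← (hT.eigenvectorBasis hd).sum_inner_mul_inner, Complex.re_sum]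
  refine Finset.sum_congr rfl fun j _ => ?_
  rw [← hT, hT.apply_eigenvectorBasis, inner_smul_left, ← inner_conj_symm x]
  have key : ∀ (r : ℝ) (a : ℂ),
      ((starRingEnd ℂ) a * ((starRingEnd ℂ) (r : ℂ) * a)).re = r * ‖a‖ ^ 2 := fun r a => by
    rw [Complex.conj_ofReal, mul_left_comm, Complex.re_ofReal_mul,
      ← Complex.normSq_eq_conj_mul_self, Complex.normSq_eq_norm_sq, Complex.ofReal_re]
  exact key _ _

/-- Weyl's monotonicity principle for symmetric operators. -/
theorem eigenvalues_le_of_forall_re_inner_le {E : Type*} [NormedAddCommGroup E]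
    [InnerProductSpace ℂ E] [FiniteDimensional ℂ E] {d : ℕ} (hd : Module.finrank ℂ E = d)
    {S T : E →ₗ[ℂ] E} (hS : S.IsSymmetric) (hT : T.IsSymmetric)
    (h : ∀ x, (inner ℂ x (S x)).re ≤ (inner ℂ x (T x)).re) (i : Fin d) :
    hS.eigenvalues hd i ≤ hT.eigenvalues hd i := by
  set bS := hS.eigenvectorBasis hd
  set bT := hT.eigenvectorBasis hd
  -- A vector orthogonal to the `bS j` with `i < j` and to the `bT j` with `j < i`: these are
  -- `d - 1` linear conditions.
  let f : E →ₗ[ℂ] ({j : Fin d // j ≠ i} → ℂ) := LinearMap.pi fun j =>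
    if i < j.1 then (innerSL ℂ (bS j.1)).toLinearMap else (innerSL ℂ (bT j.1)).toLinearMap
  have hf : LinearMap.ker f ≠ ⊥ := by
    apply LinearMap.ker_ne_bot_of_finrank_lt
    rw [Module.finrank_fintype_fun_eq_card, hd, Fintype.card_subtype_compl]
    simp [i.pos]
  obtain ⟨x, hx, hx0⟩ := (Submodule.ne_bot_iff _).mp hf
  have hfx : ∀ j : Fin d, (hj : j ≠ i) → f x ⟨j, hj⟩ = 0 := fun j hj => by
    rw [LinearMap.mem_ker.mp hx]; rfl
  have hSx : ∀ j, i < j → inner ℂ (bS j) x = 0 := fun j hj => by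
    have := hfx j hj.ne'
    simpa [f, hj] using this
  have hTx : ∀ j, j < i → inner ℂ (bT j) x = 0 := fun j hj => by
    have := hfx j hj.ne
    simpa [f, hj.not_gt] using this
  have hxpos : 0 < ‖x‖ ^ 2 := by positivity
  have h1 : hS.eigenvalues hd i * ‖x‖ ^ 2 ≤ (inner ℂ x (S x)).re := by
    rw [re_inner_apply_self_eq_sum hd hS, ← bS.sum_sq_norm_inner_right, Finset.mul_sum]
    refine Finset.sum_le_sum fun j _ => ?_
    rcases le_or_gt j i with hj | hj
    · exact mul_le_mul_of_nonneg_right (hS.eigenvalues_antitone hd hj) (by positivity)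
    · have := hSx j hj
      simp [bS] at this ⊢
      simp [this]
  have h2 : (inner ℂ x (T x)).re ≤ hT.eigenvalues hd i * ‖x‖ ^ 2 := by
    rw [re_inner_apply_self_eq_sum hd hT, ← bT.sum_sq_norm_inner_right, Finset.mul_sum]
    refine Finset.sum_le_sum fun j _ => ?_
    rcases le_or_gt i j with hj | hj
    · exact mul_le_mul_of_nonneg_right (hT.eigenvalues_antitone hd hj) (by positivity)
    · have := hTx j hj
      simp [bT] at this ⊢
      simp [this]
  exact le_of_mul_le_mul_right (h1.trans ((h x).trans h2)) hxpos

theorem abs_re_quadraticForm_le {n : Type*} [Fintype n] (D : Matrix n n ℂ) (x : n → ℂ) :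
    |(star x ⬝ᵥ D *ᵥ x).re| ≤ (∑ i, ∑ j, ‖D i j‖) * ∑ i, ‖x i‖ ^ 2 := by
  have hx : ∀ i j, ‖x i‖ * ‖x j‖ ≤ ∑ k, ‖x k‖ ^ 2 := by
    intro i j
    have hi := Finset.single_le_sum (f := fun k => ‖x k‖ ^ 2) (fun k _ => by positivity)
      (Finset.mem_univ i)
    have hj := Finset.single_le_sum (f := fun k => ‖x k‖ ^ 2) (fun k _ => by positivity)
      (Finset.mem_univ j)
    nlinarith [sq_nonneg (‖x i‖ - ‖x j‖)]
  refine (Complex.abs_re_le_norm _).trans ?_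
  rw [dotProduct, Finset.sum_mul]
  refine (norm_sum_le _ _).trans (Finset.sum_le_sum fun i _ => ?_)
  rw [mulVec, dotProduct, Finset.mul_sum, Finset.sum_mul]
  refine (norm_sum_le _ _).trans (Finset.sum_le_sum fun j _ => ?_)
  rw [norm_mul, norm_mul, Pi.star_apply, norm_star, mul_left_comm]
  exact mul_le_mul_of_nonneg_left (hx i j) (norm_nonneg _)

variable {n : Type*} [Fintype n] [DecidableEq n]

/-- Weyl's monotonicity principle: the ordered eigenvalues increase with the quadratic form. -/
theorem eigenvalues₀_le_of_forall_re_le {A B : Matrix n n ℂ} (hA : A.IsHermitian)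
    (hB : B.IsHermitian) (h : ∀ x : n → ℂ, (star x ⬝ᵥ A *ᵥ x).re ≤ (star x ⬝ᵥ B *ᵥ x).re)
    (i : Fin (Fintype.card n)) : hA.eigenvalues₀ i ≤ hB.eigenvalues₀ i := by
  refine eigenvalues_le_of_forall_re_inner_le _ _ _ (fun x => ?_) i
  have := h x.ofLp
  simpa [EuclideanSpace.inner_eq_star_dotProduct, dotProduct_comm] using this

theorem sum_eigenvalues₀ {A : Matrix n n ℂ} (hA : A.IsHermitian) :
    ∑ i, hA.eigenvalues₀ i = A.trace.re := by
  rw [hA.trace_eq_sum_eigenvalues, Complex.re_sum]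
  exact (Equiv.sum_comp (Fintype.equivOfCardEq (Fintype.card_fin _)).symm
    hA.eigenvalues₀).symm

theorem eigenvalues₀_eq_of_charpoly_eq {A B : Matrix n n ℂ} (hA : A.IsHermitian)
    (hB : B.IsHermitian) (h : A.charpoly = B.charpoly) : hA.eigenvalues₀ = hB.eigenvalues₀ := by
  rw [← List.ofFn_inj, ← hA.sort_roots_charpoly_eq_eigenvalues₀,
    ← hB.sort_roots_charpoly_eq_eigenvalues₀, h]

theorem re_quadraticForm_smul_one (s : ℝ) (x : n → ℂ) :
    (star x ⬝ᵥ ((s : ℂ) • (1 : Matrix n n ℂ)) *ᵥ x).re = s * ∑ i, ‖x i‖ ^ 2 := by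
  rw [smul_mulVec, one_mulVec, dotProduct_smul, smul_eq_mul, Complex.re_ofReal_mul, dotProduct,
    Complex.re_sum]
  congr 1
  refine Finset.sum_congr rfl fun i _ => ?_
  rw [Pi.star_apply, RCLike.star_def, ← Complex.normSq_eq_conj_mul_self, Complex.ofReal_re,
    Complex.normSq_eq_norm_sq]

/-- A Lipschitz bound with a non-optimal constant, from the monotonicity principle and the trace of
`B + s` with `s = ∑ |A i j - B i j|`. -/
theorem eigenvalues₀_sub_le {A B : Matrix n n ℂ} (hA : A.IsHermitian) (hB : B.IsHermitian)
    (i : Fin (Fintype.card n)) :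
    hA.eigenvalues₀ i - hB.eigenvalues₀ i
      ≤ Fintype.card n * ∑ i, ∑ j, ‖A i j - B i j‖ := by
  set s := ∑ i, ∑ j, ‖A i j - B i j‖ with hs
  have hs0 : 0 ≤ s := by positivity
  have hC : (B + (s : ℂ) • (1 : Matrix n n ℂ)).IsHermitian := by
    refine hB.add ?_
    simp [IsHermitian, conjTranspose_smul]
  have h1 : hA.eigenvalues₀ i ≤ hC.eigenvalues₀ i := by
    refine eigenvalues₀_le_of_forall_re_le hA hC (fun x => ?_) i
    have h := (abs_le.mp (abs_re_quadraticForm_le (A - B) x)).2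
    simp only [Matrix.sub_apply] at h
    rw [sub_mulVec, dotProduct_sub, Complex.sub_re] at h
    rw [add_mulVec, dotProduct_add, Complex.add_re, re_quadraticForm_smul_one]
    linarith
  have h2 : ∀ k, 0 ≤ hC.eigenvalues₀ k - hB.eigenvalues₀ k := by
    refine fun k => sub_nonneg.mpr (eigenvalues₀_le_of_forall_re_le hB hC (fun x => ?_) k)
    rw [add_mulVec, dotProduct_add, Complex.add_re, re_quadraticForm_smul_one]
    have : 0 ≤ s * ∑ i, ‖x i‖ ^ 2 := by positivity
    linarith
  have h3 := Finset.single_le_sum (fun k _ => h2 k) (Finset.mem_univ i)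
  rw [Finset.sum_sub_distrib, sum_eigenvalues₀, sum_eigenvalues₀, trace_add, trace_smul, trace_one]
    at h3
  have h4 : (B.trace + (s : ℂ) • (Fintype.card n : ℂ)).re - B.trace.re = Fintype.card n * s := by
    simp [mul_comm]
  linarith

theorem continuous_eigenvalues₀ {X : Type*} [TopologicalSpace X] {M : X → Matrix n n ℂ}
    (hM : ∀ x, (M x).IsHermitian) (hc : Continuous M) (i : Fin (Fintype.card n)) :
    Continuous fun x => (hM x).eigenvalues₀ i := by
  rw [continuous_iff_continuousAt]
  intro x₀
  rw [ContinuousAt, tendsto_iff_norm_sub_tendsto_zero]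
  have hlim : Filter.Tendsto (fun x => (Fintype.card n : ℝ) * ∑ i, ∑ j, ‖M x i j - M x₀ i j‖)
      (nhds x₀) (nhds 0) := by
    have hcont : Continuous fun x => (Fintype.card n : ℝ) * ∑ i, ∑ j, ‖M x i j - M x₀ i j‖ := by
      have : ∀ i j, Continuous fun x => M x i j := fun i j => hc.matrix_elem i j
      fun_prop
    simpa using hcont.tendsto x₀
  refine squeeze_zero (fun x => norm_nonneg _) (fun x => ?_) hlim
  rw [Real.norm_eq_abs, abs_le]
  have h1 := eigenvalues₀_sub_le (hM x) (hM x₀) i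
  have h2 := eigenvalues₀_sub_le (hM x₀) (hM x) i
  simp only [norm_sub_rev (M x₀ _ _)] at h2
  constructor <;> linarith

end Eigenvalues

/-! ### The Bloch transform and the Cayley–Hamilton identity on finitely supported sequences -/

section Bloch

variable {q : ℕ} [NeZero q] {ω : ℂ}

/-- The residue class of an integer modulo `q`, as an element of `Fin q`. -/
def residue (q : ℕ) [NeZero q] (m : ℤ) : Fin q :=
  ⟨(m % q).toNat, by
    have h := Int.emod_lt_of_pos m (Int.natCast_pos.mpr (Nat.pos_of_neZero q))
    have h' := Int.emod_nonneg m (Int.natCast_ne_zero.mpr (NeZero.ne q))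
    omega⟩

theorem residue_val (m : ℤ) : ((residue q m : ℕ) : ℤ) = m % q :=
  Int.toNat_of_nonneg (Int.emod_nonneg m (Int.natCast_ne_zero.mpr (NeZero.ne q)))

theorem residue_natCast (i : Fin q) : residue q ((i : ℕ) : ℤ) = i := by
  ext
  have h := residue_val (q := q) (i : ℕ)
  rw [Int.emod_eq_of_lt (by positivity) (by exact_mod_cast i.2)] at h
  exact_mod_cast h

theorem residue_add_one (m : ℤ) : residue q (m + 1) = residue q m + 1 := by
  ext
  have h1 := residue_val (q := q) (m + 1)
  have h2 : (((residue q m + 1 : Fin q) : ℕ) : ℤ) = (m + 1) % q := by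
    rw [Fin.val_add, Fin.val_one', Nat.add_mod_mod]
    push_cast
    rw [residue_val, Int.emod_add_emod]
  exact_mod_cast h1.trans h2.symm

theorem residue_add_mul (m l : ℤ) : residue q (m + q * l) = residue q m := by
  ext
  have h1 := residue_val (q := q) (m + q * l)
  have h2 := residue_val (q := q) m
  rw [Int.add_mul_emod_self_left, ← h2] at h1
  exact_mod_cast h1

theorem pow_residue (hω : ω ^ q = 1) (m : ℤ) : ω ^ (residue q m : ℕ) = ω ^ m := by
  rw [← zpow_natCast, residue_val]
  have hω0 : ω ≠ 0 := by
    rintro rfl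
    simp [NeZero.ne q] at hω
  conv_rhs => rw [← Int.mul_ediv_add_emod m q, zpow_add₀ hω0, _root_.zpow_mul, zpow_natCast,
    hω, _root_.one_zpow, one_mul]

theorem shiftMatrix_mulVec_apply (w : Fin q → ℂ) (m : ℤ) :
    (shiftMatrix q *ᵥ w) (residue q m) = w (residue q (m + 1)) := by
  simp [shiftMatrix, mulVec, dotProduct, residue_add_one]

theorem transpose_shiftMatrix_mulVec_apply (w : Fin q → ℂ) (m : ℤ) :
    ((shiftMatrix q)ᵀ *ᵥ w) (residue q m) = w (residue q (m - 1)) := by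
  have h : residue q m = residue q (m - 1) + 1 := by rw [← residue_add_one, sub_add_cancel]
  simp [shiftMatrix, mulVec, dotProduct, h]

theorem clockMatrix_mulVec_apply (hω : ω ^ q = 1) (w : Fin q → ℂ) (m : ℤ) :
    (clockMatrix q ω *ᵥ w) (residue q m) = ω ^ m * w (residue q m) := by
  rw [clockMatrix, mulVec_diagonal, pow_residue hω]

theorem fibreMatrix_mulVec_apply (hω : ω ^ q = 1) (y z : ℂ) (w : Fin q → ℂ) (m : ℤ) :
    (fibreMatrix q ω y z *ᵥ w) (residue q m)
      = y * (1 + z * ω ^ m) * w (residue q (m + 1))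
        + y⁻¹ * (1 + z⁻¹ * ω⁻¹ ^ (m - 1)) * w (residue q (m - 1))
        + (z * ω ^ m + z⁻¹ * ω⁻¹ ^ m) * w (residue q m) := by
  have hω' : ω⁻¹ ^ q = 1 := by rw [inv_pow, hω, inv_one]
  simp only [fibreMatrix, add_mulVec, smul_mulVec, ← mulVec_mulVec, one_mulVec, Pi.add_apply,
    Pi.smul_apply, smul_eq_mul, clockMatrix_mulVec_apply hω, clockMatrix_mulVec_apply hω',
    shiftMatrix_mulVec_apply, transpose_shiftMatrix_mulVec_apply]
  ring

theorem residue_eq_add_one_iff (i j : Fin q) (m : ℤ) (hj : residue q m = j) :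
    i + 1 = j ↔ i = residue q (m - 1) := by
  have h : residue q m = residue q (m - 1) + 1 := by rw [← residue_add_one, sub_add_cancel]
  rw [← hj, h]
  exact add_left_inj 1

theorem shiftMatrix_mulVec_single (m : ℤ) :
    shiftMatrix q *ᵥ Pi.single (residue q m) 1 = Pi.single (residue q (m - 1)) 1 := by
  ext i
  simp [shiftMatrix, Pi.single_apply, residue_eq_add_one_iff i _ m rfl]

theorem transpose_shiftMatrix_mulVec_single (m : ℤ) :
    (shiftMatrix q)ᵀ *ᵥ Pi.single (residue q m) 1 = Pi.single (residue q (m + 1)) 1 := by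
  ext i
  simp [shiftMatrix, Pi.single_apply, residue_add_one, eq_comm]

theorem clockMatrix_mulVec_single (hω : ω ^ q = 1) (m : ℤ) :
    clockMatrix q ω *ᵥ Pi.single (residue q m) 1 = ω ^ m • Pi.single (residue q m) 1 := by
  ext i
  by_cases h : i = residue q m
  · subst h
    simp [clockMatrix, mulVec_diagonal, pow_residue hω]
  · simp [clockMatrix, mulVec_diagonal, h]

theorem fibreMatrix_mulVec_single (hω : ω ^ q = 1) (y z : ℂ) (m : ℤ) :
    fibreMatrix q ω y z *ᵥ Pi.single (residue q m) 1
      = (y * (1 + z * ω ^ (m - 1))) • Pi.single (residue q (m - 1)) 1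
        + (y⁻¹ * (1 + z⁻¹ * ω⁻¹ ^ m)) • Pi.single (residue q (m + 1)) 1
        + (z * ω ^ m + z⁻¹ * ω⁻¹ ^ m) • Pi.single (residue q m) 1 := by
  have hω' : ω⁻¹ ^ q = 1 := by rw [inv_pow, hω, inv_one]
  simp only [fibreMatrix, add_mulVec, smul_mulVec, ← mulVec_mulVec, one_mulVec, mulVec_add,
    mulVec_smul, clockMatrix_mulVec_single hω, clockMatrix_mulVec_single hω',
    shiftMatrix_mulVec_single, transpose_shiftMatrix_mulVec_single]
  module

/-- The polynomial `P` with `det (x - h) = P(x) - g` for every fibre `h`. It is defined from the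
fibre at `y = z = 1`; that every other fibre gives the same polynomial is Chambers' formula
`charpoly_fibreMatrix`. -/
noncomputable def chambersPolynomial (q : ℕ) [NeZero q] (ω : ℂ) : ℂ[X] :=
  (fibreMatrix q ω 1 1).charpoly + C (chambersTerm q 1 1)

theorem charpoly_fibreMatrix (hω : IsPrimitiveRoot ω q) {y z : ℂ} (hy : y ≠ 0) (hz : z ≠ 0) :
    (fibreMatrix q ω y z).charpoly = chambersPolynomial q ω - C (chambersTerm q y z) := by
  rw [chambersPolynomial, eq_sub_iff_add_eq]
  apply Polynomial.funext
  intro E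
  simp only [eval_add, eval_charpoly, eval_C, scalar_apply, ← smul_one_eq_diagonal]
  exact det_add_chambersTerm_eq hω E hy hz one_ne_zero one_ne_zero

theorem aeval_chambersPolynomial (hω : IsPrimitiveRoot ω q) {y z : ℂ} (hy : y ≠ 0) (hz : z ≠ 0) :
    aeval (fibreMatrix q ω y z) (chambersPolynomial q ω)
      = chambersTerm q y z • (1 : Matrix (Fin q) (Fin q) ℂ) := by
  have h := aeval_self_charpoly (fibreMatrix q ω y z)
  rw [charpoly_fibreMatrix hω hy hz, map_sub, sub_eq_zero, aeval_C] at h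
  rw [h, Algebra.algebraMap_eq_smul_one]

/-- The Jacobi operator with `c = 1 + z ω^m` and `v = z ω^m + z⁻¹ ω^{-m}` at site `m`, on finitely
supported sequences. -/
noncomputable def hoppingMap (ω z : ℂ) : (ℤ →₀ ℂ) →ₗ[ℂ] (ℤ →₀ ℂ) :=
  Finsupp.linearCombination ℂ fun m : ℤ =>
    (1 + z * ω ^ (m - 1)) • Finsupp.single (m - 1) 1
      + (1 + z⁻¹ * ω⁻¹ ^ m) • Finsupp.single (m + 1) 1
      + (z * ω ^ m + z⁻¹ * ω⁻¹ ^ m) • Finsupp.single m 1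

/-- The operator `α T + α' T⁻¹ + β`, with `T` the translation by `q` sites, whose symbol is
`chambersTerm q · z`, on finitely supported sequences. -/
noncomputable def chambersMap (q : ℕ) (z : ℂ) : (ℤ →₀ ℂ) →ₗ[ℂ] (ℤ →₀ ℂ) :=
  Finsupp.linearCombination ℂ fun m : ℤ =>
    (1 - (-z) ^ q) • Finsupp.single (m - q) 1 + (1 - (-z⁻¹) ^ q) • Finsupp.single (m + q) 1
      + (z ^ q + z⁻¹ ^ q) • Finsupp.single m 1

/-- The Bloch transform `(F_y f)_i = ∑_{m ≡ i} y^{-m} f_m` at a nonzero complex `y`. -/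
noncomputable def blochMap (q : ℕ) [NeZero q] (y : ℂ) : (ℤ →₀ ℂ) →ₗ[ℂ] (Fin q → ℂ) :=
  Finsupp.linearCombination ℂ fun m : ℤ => y ^ (-m) • Pi.single (residue q m) 1

theorem blochMap_single (y : ℂ) (m : ℤ) :
    blochMap q y (Finsupp.single m 1) = y ^ (-m) • Pi.single (residue q m) 1 := by
  simp [blochMap]

theorem blochMap_comp_hoppingMap (hω : ω ^ q = 1) {y : ℂ} (hy : y ≠ 0) (z : ℂ) :
    blochMap q y ∘ₗ hoppingMap ω z = (fibreMatrix q ω y z).mulVecLin ∘ₗ blochMap q y := by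
  refine Finsupp.lhom_ext' fun m => LinearMap.ext_ring ?_
  have h1 : y ^ (-(m - 1)) = y ^ (-m) * y := by
    rw [← zpow_add_one₀ hy]; congr 1; ring
  have h2 : y ^ (-(m + 1)) = y ^ (-m) * y⁻¹ := by
    rw [← zpow_sub_one₀ hy]; congr 1; ring
  simp only [LinearMap.comp_apply, Finsupp.lsingle_apply, hoppingMap,
    Finsupp.linearCombination_single, one_smul, map_add, map_smul, blochMap_single, h1, h2,
    mulVecLin_apply, fibreMatrix_mulVec_single hω]
  module

theorem blochMap_comp_chambersMap {y : ℂ} (hy : y ≠ 0) (z : ℂ) :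
    blochMap q y ∘ₗ chambersMap q z = chambersTerm q y z • blochMap q y := by
  refine Finsupp.lhom_ext' fun m => LinearMap.ext_ring ?_
  have h1 : y ^ (-(m - q)) = y ^ (-m) * y ^ q := by
    rw [← zpow_natCast, ← zpow_add₀ hy]; congr 1; ring
  have h2 : y ^ (-(m + q)) = y ^ (-m) * y⁻¹ ^ q := by
    rw [inv_pow, ← zpow_natCast, ← _root_.zpow_neg, ← zpow_add₀ hy]; congr 1; ring
  have h3 : residue q (m + q) = residue q m := by simpa using residue_add_mul (q := q) m 1
  have h4 : residue q (m - q) = residue q m := by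
    simpa [sub_eq_add_neg] using residue_add_mul (q := q) m (-1)
  simp only [LinearMap.comp_apply, Finsupp.lsingle_apply, chambersMap,
    Finsupp.linearCombination_single, one_smul, map_add, map_smul, blochMap_single, h1, h2, h3, h4,
    LinearMap.smul_apply, chambersTerm]
  module

/-- The Bloch transforms are jointly injective, because distinct characters of `ℂˣ` are linearly
independent. -/
theorem eq_zero_of_forall_blochMap_eq_zero {f : ℤ →₀ ℂ}
    (h : ∀ y : ℂ, y ≠ 0 → blochMap q y f = 0) : f = 0 := by
  let χ : ℤ → (ℂˣ →* ℂ) := fun m => (Units.coeHom ℂ).comp (zpowGroupHom (-m))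
  have hχ : Function.Injective χ := by
    intro m n hmn
    have h2 := DFunLike.congr_fun hmn (Units.mk0 2 two_ne_zero)
    simp only [χ, MonoidHom.comp_apply, zpowGroupHom_apply, Units.coeHom_apply,
      Units.val_zpow_eq_zpow_val, Units.val_mk0] at h2
    have h3 : ((2 : ℝ) ^ (-m)) = (2 : ℝ) ^ (-n) := by
      apply Complex.ofReal_injective
      push_cast
      exact h2
    have := zpow_right_injective₀ (by norm_num : (0 : ℝ) < 2) (by norm_num) h3
    omega
  have hli := (linearIndependent_monoidHom ℂˣ ℂ).comp χ hχ
  rw [linearIndependent_iff] at hli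
  apply hli
  ext y
  have hy := congrArg (fun w : Fin q → ℂ => ∑ i, w i) (h y y.ne_zero)
  simp only [blochMap, Finsupp.linearCombination_apply, Finsupp.sum, Finset.sum_apply,
    Pi.smul_apply, smul_eq_mul, Pi.zero_apply, Finset.sum_const_zero] at hy
  rw [Finset.sum_comm] at hy
  simp only [← Finset.mul_sum, Finset.sum_pi_single', Finset.mem_univ, if_true, mul_one] at hy
  simpa [Finsupp.linearCombination_apply, Finsupp.sum, χ] using hy

/-- An intertwining relation passes to polynomials. -/
theorem comp_aeval_eq_of_comp_eq {V V' : Type*} [AddCommGroup V] [Module ℂ V] [AddCommGroup V']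
    [Module ℂ V'] {F : V →ₗ[ℂ] V'} {A : V →ₗ[ℂ] V} {B : V' →ₗ[ℂ] V'}
    (h : F ∘ₗ A = B ∘ₗ F) (p : ℂ[X]) (v : V) : F (aeval A p v) = aeval B p (F v) := by
  have hpow : ∀ (k : ℕ) (v : V), F ((A ^ k) v) = (B ^ k) (F v) := by
    intro k
    induction k with
    | zero => simp
    | succ k ih =>
      intro v
      rw [pow_succ, pow_succ, Module.End.mul_apply, Module.End.mul_apply, ih]
      congr 1
      exact LinearMap.congr_fun h v
  induction p using Polynomial.induction_on' with
  | add p r hp hr => simp [hp, hr]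
  | monomial k a => simp [aeval_monomial, hpow, Algebra.algebraMap_eq_smul_one]

/-- The Cayley–Hamilton theorem in the fibres, carried over to finitely supported sequences by the
Bloch transform. -/
theorem aeval_hoppingMap (hω : IsPrimitiveRoot ω q) {z : ℂ} (hz : z ≠ 0) :
    aeval (hoppingMap ω z) (chambersPolynomial q ω) = chambersMap q z := by
  refine Finsupp.lhom_ext' fun m => LinearMap.ext_ring ?_
  rw [← sub_eq_zero, LinearMap.comp_apply, LinearMap.comp_apply, Finsupp.lsingle_apply]
  apply eq_zero_of_forall_blochMap_eq_zero (q := q)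
  intro y hy
  have h1 := comp_aeval_eq_of_comp_eq (blochMap_comp_hoppingMap hω.pow_eq_one hy z)
    (chambersPolynomial q ω) (Finsupp.single m 1)
  have h2 := LinearMap.congr_fun (blochMap_comp_chambersMap (q := q) hy z) (Finsupp.single m 1)
  rw [LinearMap.comp_apply, LinearMap.smul_apply] at h2
  have h3 : aeval (fibreMatrix q ω y z).mulVecLin (chambersPolynomial q ω)
      = chambersTerm q y z • (1 : (Fin q → ℂ) →ₗ[ℂ] (Fin q → ℂ)) := by
    have := aeval_algHom_apply (toLinAlgEquiv' (R := ℂ) (n := Fin q)).toAlgHom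
      (fibreMatrix q ω y z) (chambersPolynomial q ω)
    rw [aeval_chambersPolynomial hω hy hz, map_smul, map_one] at this
    exact this
  rw [map_sub, h1, h2, h3]
  simp

end Bloch

/-! ### The Floquet fibres in terms of clock and shift -/

section Floquet

/-- The character `t ↦ e^{-2πit}`. -/
noncomputable def phase (t : ℝ) : ℂ := Complex.exp (-2 * Real.pi * Complex.I * t)

theorem c_eq_one_add_phase (θ : ℝ) : c θ = 1 + phase θ := rfl

theorem phase_ne_zero (t : ℝ) : phase t ≠ 0 := Complex.exp_ne_zero _

theorem phase_add (s t : ℝ) : phase (s + t) = phase s * phase t := by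
  rw [phase, phase, phase, ← Complex.exp_add]
  congr 1
  push_cast
  ring

theorem phase_int_mul (m : ℤ) (t : ℝ) : phase (m * t) = phase t ^ m := by
  rw [phase, phase, ← Complex.exp_int_mul]
  congr 1
  push_cast
  ring

theorem phase_nat_mul (m : ℕ) (t : ℝ) : phase (m * t) = phase t ^ m := by
  exact_mod_cast phase_int_mul m t

theorem conj_phase (t : ℝ) : (starRingEnd ℂ) (phase t) = (phase t)⁻¹ := by
  rw [phase, ← Complex.exp_conj, ← Complex.exp_neg]
  congr 1
  simp only [map_mul, map_neg, Complex.conj_I, Complex.conj_ofReal, map_ofNat]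
  ring

theorem v_eq_phase (t : ℝ) : (v t : ℂ) = phase t + (phase t)⁻¹ := by
  rw [v, phase, ← Complex.exp_neg]
  push_cast
  rw [Complex.two_cos, add_comm]
  congr 2 <;> ring

theorem c_add_int_mul (θ α : ℝ) (m : ℤ) : c (θ + m * α) = 1 + phase θ * phase α ^ m := by
  rw [c_eq_one_add_phase, phase_add, phase_int_mul]

theorem conj_c_add_int_mul (θ α : ℝ) (m : ℤ) :
    (starRingEnd ℂ) (c (θ + m * α)) = 1 + (phase θ)⁻¹ * (phase α)⁻¹ ^ m := by
  rw [c_add_int_mul, map_add, map_mul, map_zpow₀, conj_phase, conj_phase, map_one]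

theorem v_add_int_mul (θ α : ℝ) (m : ℤ) :
    (v (θ + m * α) : ℂ) = phase θ * phase α ^ m + (phase θ)⁻¹ * (phase α)⁻¹ ^ m := by
  rw [v_eq_phase, phase_add, phase_int_mul, mul_inv, _root_.inv_zpow]

theorem charpoly_floquet_eq_prod (Φ : ℝ) (q : ℕ) (θ k : ℝ) :
    (floquet Φ q θ k).charpoly = ∏ j : Fin q, (X - C (bandFunction Φ q j θ k : ℂ)) := by
  let F : Fin (Fintype.card (Fin q)) → ℂ[X] := fun i =>
    X - C (((floquet_isHermitian Φ q θ k).eigenvalues₀ i : ℝ) : ℂ)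
  exact (floquet_isHermitian Φ q θ k).charpoly_eq.trans
    ((Equiv.prod_comp (Fintype.equivOfCardEq (Fintype.card_fin _)).symm F).trans
      (Equiv.prod_comp (Fin.revPerm.trans (finCongr (Fintype.card_fin q).symm)) F).symm)

theorem exists_eigenvector (Φ : ℝ) {q : ℕ} (j : Fin q) (θ k : ℝ) :
    ∃ w : Fin q → ℂ, w ≠ 0 ∧ floquet Φ q θ k *ᵥ w = (bandFunction Φ q j θ k : ℂ) • w := by
  have h : (floquet Φ q θ k).charpoly.eval (bandFunction Φ q j θ k : ℂ) = 0 := by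
    rw [charpoly_floquet_eq_prod, eval_prod, Finset.prod_eq_zero (Finset.mem_univ j) (by simp)]
  rw [eval_charpoly, ← exists_mulVec_eq_zero_iff] at h
  obtain ⟨w, hw, hw0⟩ := h
  refine ⟨w, hw, ?_⟩
  rw [sub_mulVec, sub_eq_zero, scalar_apply, ← smul_one_eq_diagonal, smul_mulVec, one_mulVec]
    at hw0
  exact hw0.symm

/-- The values of `chambersTerm` on the torus `y = e^{ik}`, `z = e^{-2πiθ}`. -/
noncomputable def chambersFunction (q : ℕ) (θ k : ℝ) : ℝ :=
  2 * Real.cos (q * k) + 2 * Real.cos (2 * Real.pi * (q * θ))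
    - (-1) ^ q * (2 * Real.cos (q * k - 2 * Real.pi * (q * θ)))

theorem chambersTerm_eq_ofReal (q : ℕ) (θ k : ℝ) :
    chambersTerm q (Complex.exp (Complex.I * k)) (phase θ) = (chambersFunction q θ k : ℂ) := by
  have hz : phase θ ^ q = (Complex.exp ((2 * Real.pi * (q * θ) : ℝ) * Complex.I))⁻¹ := by
    rw [← phase_nat_mul, phase, ← Complex.exp_neg]
    congr 1
    push_cast
    ring
  have hy : Complex.exp (Complex.I * k) ^ q = Complex.exp ((q * k : ℝ) * Complex.I) := by
    rw [← Complex.exp_nat_mul]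
    congr 1
    push_cast
    ring
  have hcos : ∀ x : ℂ, 2 * Complex.cos x
      = Complex.exp (x * Complex.I) + (Complex.exp (x * Complex.I))⁻¹ := fun x => by
    rw [Complex.two_cos, neg_mul, Complex.exp_neg]
  rw [chambersTerm, chambersFunction, neg_pow, neg_pow (phase θ)⁻¹, inv_pow, inv_pow, hz, hy]
  push_cast
  rw [hcos, hcos, hcos, sub_mul ((q : ℂ) * k), Complex.exp_sub]
  field_simp
  ring

variable {q : ℕ} [NeZero q]

theorem floquet_eq_fibreMatrix (Φ θ k : ℝ) :
    floquet Φ q θ k = fibreMatrix q (phase (Φ / (2 * Real.pi)))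
      (Complex.exp (Complex.I * k)) (phase θ) := by
  have hiff : ∀ i j : Fin q, ((i : ℕ) + 1) % q = j ↔ i + 1 = j := fun i j => by
    rw [Fin.ext_iff, Fin.val_add, Fin.val_one', Nat.add_mod_mod]
  ext i j
  have hci := c_add_int_mul θ (Φ / (2 * Real.pi)) (i : ℕ)
  have hcj := conj_c_add_int_mul θ (Φ / (2 * Real.pi)) (j : ℕ)
  have hvi := v_add_int_mul θ (Φ / (2 * Real.pi)) (i : ℕ)
  simp only [Int.cast_natCast, zpow_natCast] at hci hcj hvi
  rw [floquet, of_apply, hci, hcj, hvi, Complex.exp_neg]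
  have h1 : ∀ z ω : ℂ, ((1 : Matrix (Fin q) (Fin q) ℂ) + z • clockMatrix q ω)
      = diagonal fun i : Fin q => 1 + z * ω ^ (i : ℕ) := by
    intro z ω
    rw [clockMatrix, ← diagonal_one, ← diagonal_smul, diagonal_add]
    rfl
  rw [fibreMatrix, h1, h1]
  simp only [hiff, clockMatrix, Matrix.add_apply, Matrix.smul_apply, diagonal_mul, mul_diagonal,
    transpose_apply, shiftMatrix, of_apply, diagonal_apply, smul_eq_mul]
  split_ifs <;> ring

theorem isPrimitiveRoot_phase {Φ : ℝ} {p : ℤ} (hpq : IsCoprime p (q : ℤ))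
    (hΦ : Φ / (2 * Real.pi) = (p : ℝ) / (q : ℝ)) :
    IsPrimitiveRoot (phase (Φ / (2 * Real.pi))) q := by
  have h := Complex.isPrimitiveRoot_exp_of_isCoprime (-p) q (NeZero.ne q) hpq.neg_left
  rw [hΦ, phase]
  convert h using 2
  push_cast
  ring

/-- Chambers' formula for the Floquet fibres. -/
theorem charpoly_floquet {Φ : ℝ} (hω : IsPrimitiveRoot (phase (Φ / (2 * Real.pi))) q) (θ k : ℝ) :
    (floquet Φ q θ k).charpoly = chambersPolynomial q (phase (Φ / (2 * Real.pi)))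
      - C (chambersFunction q θ k : ℂ) := by
  rw [floquet_eq_fibreMatrix, charpoly_fibreMatrix hω (Complex.exp_ne_zero _) (phase_ne_zero θ),
    chambersTerm_eq_ofReal]

theorem bandFunction_eq_of_chambersFunction_eq {Φ : ℝ}
    (hω : IsPrimitiveRoot (phase (Φ / (2 * Real.pi))) q) (j : Fin q) {θ k θ' k' : ℝ}
    (h : chambersFunction q θ k = chambersFunction q θ' k') :
    bandFunction Φ q j θ k = bandFunction Φ q j θ' k' := by
  rw [bandFunction, bandFunction, eigenvalues₀_eq_of_charpoly_eq (floquet_isHermitian Φ q θ k)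
    (floquet_isHermitian Φ q θ' k')]
  rw [charpoly_floquet hω, charpoly_floquet hω, h]

theorem eval_chambersPolynomial_bandFunction {Φ : ℝ}
    (hω : IsPrimitiveRoot (phase (Φ / (2 * Real.pi))) q) (j : Fin q) (θ k : ℝ) :
    (chambersPolynomial q (phase (Φ / (2 * Real.pi)))).eval (bandFunction Φ q j θ k : ℂ)
      = chambersFunction q θ k := by
  have h := congrArg (eval (bandFunction Φ q j θ k : ℂ)) (charpoly_floquet hω θ k)
  rw [charpoly_floquet_eq_prod, eval_prod, Finset.prod_eq_zero (Finset.mem_univ j) (by simp),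
    eval_sub, eval_C] at h
  exact (sub_eq_zero.mp h.symm)

theorem exists_bandFunction_eq {Φ : ℝ} (hω : IsPrimitiveRoot (phase (Φ / (2 * Real.pi))) q)
    {θ k x : ℝ} (h : (chambersPolynomial q (phase (Φ / (2 * Real.pi)))).eval (x : ℂ)
      = chambersFunction q θ k) : ∃ j, bandFunction Φ q j θ k = x := by
  have h1 := congrArg (eval (x : ℂ)) (charpoly_floquet hω θ k)
  rw [charpoly_floquet_eq_prod, eval_prod, eval_sub, eval_C, h, sub_self,
    Finset.prod_eq_zero_iff] at h1
  obtain ⟨j, -, hj⟩ := h1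
  refine ⟨j, ?_⟩
  rw [eval_sub, eval_X, eval_C, sub_eq_zero] at hj
  exact_mod_cast hj.symm

/-- `P` takes real values on the real line. -/
theorem exists_eval_chambersPolynomial_eq_ofReal {Φ : ℝ}
    (hω : IsPrimitiveRoot (phase (Φ / (2 * Real.pi))) q) (x : ℝ) :
    ∃ r : ℝ, (chambersPolynomial q (phase (Φ / (2 * Real.pi)))).eval (x : ℂ) = r := by
  have h1 := congrArg (eval (x : ℂ)) (charpoly_floquet hω 0 0)
  rw [charpoly_floquet_eq_prod, eval_prod, eval_sub, eval_C] at h1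
  refine ⟨∏ j : Fin q, (x - bandFunction Φ q j 0 0) + chambersFunction q 0 0, ?_⟩
  rw [eq_comm, ← sub_eq_iff_eq_add.mp h1.symm |>.symm]
  simp

end Floquet

/-! ### The spectrum is contained in the union of the bands -/

section Operator

/-- The translation `(T_k u)_m = u_{m+k}` on `ℓ²(ℤ)`. -/
noncomputable def translation (k : ℤ) : ellTwo →L[ℂ] ellTwo :=
  weightedShift (fun _ => 1) (fun _ => by simp) k

theorem translation_apply (k : ℤ) (u : ellTwo) (m : ℤ) : translation k u m = u (m + k) :=
  one_mul _

theorem norm_translation_apply (k : ℤ) (u : ellTwo) : ‖translation k u‖ = ‖u‖ := by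
  have h1 := lp.norm_rpow_eq_tsum (p := 2) (by norm_num) (translation k u)
  have h2 := lp.norm_rpow_eq_tsum (p := 2) (by norm_num) u
  simp only [translation_apply, ENNReal.toReal_ofNat] at h1 h2
  have h3 := (Equiv.addRight k).tsum_eq (fun m : ℤ => ‖u m‖ ^ (2 : ℝ))
  simp only [Equiv.coe_addRight] at h3
  rw [h3, ← h2] at h1
  exact (Real.rpow_left_inj (norm_nonneg _) (norm_nonneg _) two_ne_zero).mp h1

/-- The inclusion of the finitely supported sequences in `ℓ²(ℤ)`. -/
noncomputable def finsuppToEllTwo : (ℤ →₀ ℂ) →ₗ[ℂ] ellTwo :=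
  Finsupp.linearCombination ℂ fun m : ℤ => lp.single 2 m 1

theorem finsuppToEllTwo_single (m : ℤ) :
    finsuppToEllTwo (Finsupp.single m 1) = lp.single 2 m 1 := by
  simp [finsuppToEllTwo]

theorem ext_of_finsuppToEllTwo {A B : ellTwo →L[ℂ] ellTwo}
    (h : ∀ f, A (finsuppToEllTwo f) = B (finsuppToEllTwo f)) : A = B := by
  refine lp.ext_continuousLinearMap (by simp) fun m => ?_
  ext1
  have := h (Finsupp.single m 1)
  rw [finsuppToEllTwo_single] at this
  exact this

/-- The continuous extension of `chambersMap` to `ℓ²(ℤ)`. -/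
noncomputable def chambersOperator (q : ℕ) (z : ℂ) : ellTwo →L[ℂ] ellTwo :=
  (1 - (-z) ^ q) • translation q + (1 - (-z⁻¹) ^ q) • translation (-q)
    + (z ^ q + z⁻¹ ^ q) • ContinuousLinearMap.id ℂ ellTwo

theorem finsuppToEllTwo_comp_chambersMap (q : ℕ) (z : ℂ) :
    finsuppToEllTwo ∘ₗ chambersMap q z
      = (chambersOperator q z).toLinearMap ∘ₗ finsuppToEllTwo := by
  refine Finsupp.lhom_ext' fun m => LinearMap.ext_ring ?_
  simp only [LinearMap.comp_apply, Finsupp.lsingle_apply, chambersMap,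
    Finsupp.linearCombination_single, one_smul, map_add, map_smul, finsuppToEllTwo_single]
  ext n
  change (1 - (-z) ^ q) * (lp.single 2 (m - q : ℤ) (1 : ℂ) : ellTwo) n
      + (1 - (-z⁻¹) ^ q) * (lp.single 2 (m + q : ℤ) (1 : ℂ) : ellTwo) n
      + (z ^ q + z⁻¹ ^ q) * (lp.single 2 m (1 : ℂ) : ellTwo) n
    = (1 - (-z) ^ q) * translation q (lp.single 2 m (1 : ℂ)) n
      + (1 - (-z⁻¹) ^ q) * translation (-q) (lp.single 2 m (1 : ℂ)) n
      + (z ^ q + z⁻¹ ^ q) * (lp.single 2 m (1 : ℂ) : ellTwo) n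
  simp only [translation_apply, lp.single_apply, Pi.single_apply]
  simp only [eq_sub_iff_add_eq, ← sub_eq_add_neg, sub_eq_iff_eq_add]

theorem finsuppToEllTwo_comp_hoppingMap (Φ θ : ℝ) :
    finsuppToEllTwo ∘ₗ hoppingMap (phase (Φ / (2 * Real.pi))) (phase θ)
      = (H Φ θ).toLinearMap ∘ₗ finsuppToEllTwo := by
  refine Finsupp.lhom_ext' fun m => LinearMap.ext_ring ?_
  simp only [LinearMap.comp_apply, Finsupp.lsingle_apply, hoppingMap,
    Finsupp.linearCombination_single, one_smul, map_add, map_smul, finsuppToEllTwo_single]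
  ext n
  change (1 + phase θ * phase (Φ / (2 * Real.pi)) ^ (m - 1))
        * (lp.single 2 (m - 1 : ℤ) (1 : ℂ) : ellTwo) n
      + (1 + (phase θ)⁻¹ * (phase (Φ / (2 * Real.pi)))⁻¹ ^ m)
        * (lp.single 2 (m + 1 : ℤ) (1 : ℂ) : ellTwo) n
      + (phase θ * phase (Φ / (2 * Real.pi)) ^ m
        + (phase θ)⁻¹ * (phase (Φ / (2 * Real.pi)))⁻¹ ^ m) * (lp.single 2 m (1 : ℂ) : ellTwo) n
    = H Φ θ (lp.single 2 m (1 : ℂ)) n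
  have h1 := c_add_int_mul θ (Φ / (2 * Real.pi)) n
  have h2 := conj_c_add_int_mul θ (Φ / (2 * Real.pi)) (n - 1)
  have h3 := v_add_int_mul θ (Φ / (2 * Real.pi)) n
  push_cast at h2
  rw [H_apply, h1, h2, h3]
  simp only [lp.single_apply, Pi.single_apply, eq_sub_iff_add_eq, sub_eq_iff_eq_add]
  have e1 : (1 + phase θ * phase (Φ / (2 * Real.pi)) ^ (m - 1)) * (if n + 1 = m then (1 : ℂ) else 0)
      = (1 + phase θ * phase (Φ / (2 * Real.pi)) ^ n) * (if n + 1 = m then 1 else 0) := by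
    split_ifs with h
    · rw [← h, add_sub_cancel_right]
    · simp
  have e2 : (1 + (phase θ)⁻¹ * (phase (Φ / (2 * Real.pi)))⁻¹ ^ m)
        * (if n = m + 1 then (1 : ℂ) else 0)
      = (1 + (phase θ)⁻¹ * (phase (Φ / (2 * Real.pi)))⁻¹ ^ (n - 1))
        * (if n = m + 1 then 1 else 0) := by
    split_ifs with h
    · rw [h, add_sub_cancel_right]
    · simp
  rw [e1, e2]
  congr 1
  split_ifs with h
  · rw [h]
  · simp

theorem toLinearMap_aeval (A : ellTwo →L[ℂ] ellTwo) (p : ℂ[X]) (u : ellTwo) :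
    aeval A p u = aeval A.toLinearMap p u := by
  induction p using Polynomial.induction_on' with
  | add p r hp hr => simp [hp, hr]
  | monomial k a =>
    have : ∀ (k : ℕ) (u : ellTwo), (A ^ k) u = (A.toLinearMap ^ k) u := by
      intro k
      induction k with
      | zero => intro u; rfl
      | succ k ih =>
        intro u
        rw [pow_succ, pow_succ, Module.End.mul_apply]
        exact ih (A u)
    simp [aeval_monomial, this, Algebra.algebraMap_eq_smul_one]

/-- `P(H)` is the translation-invariant operator with symbol `g(θ, ·)`. -/
theorem aeval_H {q : ℕ} [NeZero q] {Φ : ℝ} (hω : IsPrimitiveRoot (phase (Φ / (2 * Real.pi))) q)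
    (θ : ℝ) : aeval (H Φ θ) (chambersPolynomial q (phase (Φ / (2 * Real.pi))))
      = chambersOperator q (phase θ) := by
  apply ext_of_finsuppToEllTwo
  intro f
  rw [toLinearMap_aeval, ← comp_aeval_eq_of_comp_eq (finsuppToEllTwo_comp_hoppingMap Φ θ),
    aeval_hoppingMap hω (phase_ne_zero θ)]
  exact LinearMap.congr_fun (finsuppToEllTwo_comp_chambersMap q (phase θ)) f

theorem mem_spectrum_real_iff (x : ℝ) (A : ellTwo →L[ℂ] ellTwo) :
    x ∈ spectrum ℝ A ↔ (x : ℂ) ∈ spectrum ℂ A := by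
  have h : algebraMap ℝ (ellTwo →L[ℂ] ellTwo) x
      = algebraMap ℂ (ellTwo →L[ℂ] ellTwo) (x : ℂ) := by
    rw [Algebra.algebraMap_eq_smul_one, Algebra.algebraMap_eq_smul_one]
    ext u m
    rfl
  rw [spectrum.mem_iff, spectrum.mem_iff, h]

/-- The trigonometric polynomial `α e^{ix} + ᾱ e^{-ix}` takes every value in `[-2|α|, 2|α|]`. -/
theorem exists_mul_exp_add_eq {α : ℂ} {r : ℝ} (h : |r| ≤ 2 * ‖α‖) :
    ∃ x : ℝ, α * Complex.exp (x * Complex.I) + (starRingEnd ℂ) α * Complex.exp (-(x * Complex.I))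
      = r := by
  refine ⟨Real.arccos (r / (2 * ‖α‖)) - α.arg, ?_⟩
  have h1 : ∀ x : ℝ, (starRingEnd ℂ) (α * Complex.exp (x * Complex.I))
      = (starRingEnd ℂ) α * Complex.exp (-(x * Complex.I)) := by
    intro x
    rw [map_mul, ← Complex.exp_conj]
    simp
  rw [← h1, Complex.add_conj]
  congr 1
  nth_rewrite 1 [← Complex.norm_mul_exp_arg_mul_I α]
  rw [mul_assoc, ← Complex.exp_add, Complex.re_ofReal_mul, Complex.ofReal_sub, sub_mul,
    add_sub_cancel, Complex.exp_ofReal_mul_I_re]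
  rcases (norm_nonneg α).eq_or_lt with h0 | h0
  · rw [← h0] at h ⊢
    have : r = 0 := by simpa using h
    simp [this]
  · have hb := abs_le.mp h
    rw [Real.cos_arccos]
    · field_simp
    · rw [le_div_iff₀ (by positivity)]; linarith
    · rw [div_le_iff₀ (by positivity)]; linarith

/-- A point `x` of the spectrum of `H Φ θ` satisfies `P(x) = g(θ, k)` for some `k`, because
`P(x) - β` is in the spectrum of `α T + ᾱ T⁻¹`, an operator of norm at most `2 |α|`. -/
theorem spectrum_H_subset {q : ℕ} [NeZero q] {Φ : ℝ}
    (hω : IsPrimitiveRoot (phase (Φ / (2 * Real.pi))) q) {θ x : ℝ}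
    (hx : x ∈ spectrum ℝ (H Φ θ)) : ∃ (j : Fin q) (k : ℝ), bandFunction Φ q j θ k = x := by
  obtain ⟨r, hr⟩ := exists_eval_chambersPolynomial_eq_ofReal hω x
  set P := chambersPolynomial q (phase (Φ / (2 * Real.pi)))
  set z := phase θ with hz
  obtain ⟨b, hb⟩ : ∃ b : ℝ, z ^ q + z⁻¹ ^ q = b := by
    refine ⟨2 * (z ^ q).re, ?_⟩
    rw [← conj_phase, ← map_pow, Complex.add_conj]
  set α : ℂ := 1 - (-z) ^ q with hα
  have hα' : 1 - (-z⁻¹) ^ q = (starRingEnd ℂ) α := by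
    rw [hα, map_sub, map_one, map_pow, map_neg, conj_phase]
  have hx' : (x : ℂ) ∈ spectrum ℂ (H Φ θ) := (mem_spectrum_real_iff x _).mp hx
  have h1 := spectrum.subset_polynomial_aeval (H Φ θ) (P - C (b : ℂ))
    ⟨(x : ℂ), hx', rfl⟩
  have h2 : aeval (H Φ θ) (P - C (b : ℂ))
      = α • translation q + (starRingEnd ℂ) α • translation (-q) := by
    rw [map_sub, aeval_H hω, aeval_C, Algebra.algebraMap_eq_smul_one, chambersOperator, ← hz,
      hb, ← hα, hα']
    exact add_sub_cancel_right _ _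
  have h3 : ‖α • translation q + (starRingEnd ℂ) α • translation (-q)‖ ≤ 2 * ‖α‖ := by
    refine ContinuousLinearMap.opNorm_le_bound _ (by positivity) fun u => ?_
    change ‖α • translation q u + (starRingEnd ℂ) α • translation (-q) u‖ ≤ 2 * ‖α‖ * ‖u‖
    refine (norm_add_le _ _).trans ?_
    rw [norm_smul, norm_smul, norm_translation_apply, norm_translation_apply, RCLike.norm_conj]
    linarith
  have h4 := (spectrum.norm_le_norm_mul_of_mem h1)
  rw [h2] at h4
  have h5 : ‖(1 : ellTwo →L[ℂ] ellTwo)‖ ≤ 1 := ContinuousLinearMap.norm_id_le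
  have h6 : |r - b| ≤ 2 * ‖α‖ := by
    simp only [eval_sub, eval_C, hr] at h4
    rw [← Complex.ofReal_sub, Complex.norm_real, Real.norm_eq_abs] at h4
    calc |r - b| ≤ _ := h4
      _ ≤ (2 * ‖α‖) * 1 := by gcongr
      _ = _ := mul_one _
  obtain ⟨t, ht⟩ := exists_mul_exp_add_eq h6
  have hq : (q : ℝ) ≠ 0 := Nat.cast_ne_zero.mpr (NeZero.ne q)
  suffices h7 : P.eval (x : ℂ) = (chambersFunction q θ (t / q) : ℂ) by
    obtain ⟨j, hj⟩ := exists_bandFunction_eq hω h7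
    exact ⟨j, t / q, hj⟩
  have hy : Complex.exp (Complex.I * ((t / q : ℝ) : ℂ)) ^ q = Complex.exp (t * Complex.I) := by
    rw [← Complex.exp_nat_mul]
    congr 1
    push_cast
    have : (q : ℂ) ≠ 0 := Nat.cast_ne_zero.mpr (NeZero.ne q)
    field_simp
  rw [← chambersTerm_eq_ofReal, chambersTerm, inv_pow, hy, ← Complex.exp_neg, ← hz, hb, ← hα, hα',
    ht, hr]
  push_cast
  ring

end Operator

/-! ### Bloch waves and the reverse inclusion -/

section Weyl

theorem exists_norm_le_mul_of_notMem_spectrum {A : ellTwo →L[ℂ] ellTwo} {x : ℂ}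
    (hx : x ∉ spectrum ℂ A) : ∃ K : ℝ, ∀ u, ‖u‖ ≤ K * ‖x • u - A u‖ := by
  rw [spectrum.notMem_iff] at hx
  obtain ⟨R, -, hR⟩ := isUnit_iff_exists.mp hx
  refine ⟨‖R‖, fun u => ?_⟩
  have h := DFunLike.congr_fun hR u
  have h2 : R (x • u - A u) = u := by
    rw [Algebra.algebraMap_eq_smul_one] at h
    exact h
  calc ‖u‖ = ‖R (x • u - A u)‖ := by rw [h2]
    _ ≤ _ := R.le_opNorm _

theorem norm_sq_le_of_support (f : ellTwo) (s : Finset ℤ) (hs : ∀ m ∉ s, f m = 0) {M : ℝ}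
    (hM : ∀ m, ‖f m‖ ≤ M) : ‖f‖ ^ 2 ≤ s.card * M ^ 2 := by
  have hf : f = ∑ i ∈ s, lp.single 2 i (f i) := by
    ext m
    rw [lp.coeFn_sum, Finset.sum_apply]
    simp only [lp.single_apply]
    rw [Finset.sum_pi_single]
    split_ifs with h
    · rfl
    · exact hs m h
  have h := lp.norm_sum_single (p := 2) (by norm_num) (fun i => f i) s
  rw [← hf] at h
  simp only [ENNReal.toReal_ofNat, Real.rpow_ofNat] at h
  rw [h, ← nsmul_eq_mul]
  refine Finset.sum_le_card_nsmul _ _ _ fun i _ => ?_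
  exact pow_le_pow_left₀ (norm_nonneg _) (hM i) 2

theorem truncation_apply (β : ℤ → ℂ) (N : ℤ) (m : ℤ) :
    (∑ i ∈ Finset.Ico 0 N, lp.single 2 i (β i) : ellTwo) m
      = if 0 ≤ m ∧ m < N then β m else 0 := by
  rw [lp.coeFn_sum, Finset.sum_apply]
  simp only [lp.single_apply]
  rw [Finset.sum_pi_single]
  simp

/-- A bounded generalized eigenfunction whose modulus is periodic has its eigenvalue in the
spectrum, by Weyl's criterion. -/
theorem mem_spectrum_of_bloch_wave {q : ℕ} [NeZero q] {Φ θ x : ℝ} {β : ℤ → ℂ}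
    (hβ : ∀ m : ℤ, c (θ + m * (Φ / (2 * Real.pi))) * β (m + 1)
      + (starRingEnd ℂ) (c (θ + (m - 1) * (Φ / (2 * Real.pi)))) * β (m - 1)
      + (v (θ + m * (Φ / (2 * Real.pi))) : ℂ) * β m = x * β m)
    (hper : ∀ m l : ℤ, ‖β (m + q * l)‖ = ‖β m‖) (h0 : ∃ m, β m ≠ 0) :
    x ∈ spectrum ℝ (H Φ θ) := by
  rw [mem_spectrum_real_iff]
  by_contra hx
  obtain ⟨K, hK⟩ := exists_norm_le_mul_of_notMem_spectrum hx
  have hq : (0 : ℤ) < q := Int.natCast_pos.mpr (Nat.pos_of_neZero q)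
  have hmod : ∀ m : ℤ, ‖β (m % q)‖ = ‖β m‖ := fun m => by
    conv_rhs => rw [← Int.emod_add_mul_ediv m q, hper]
  obtain ⟨m₀, hm₀⟩ := h0
  set r := m₀ % q with hr
  have hr0 : 0 ≤ r := Int.emod_nonneg _ hq.ne'
  have hrq : r < q := Int.emod_lt_of_pos _ hq
  have hβr : 0 < ‖β r‖ := by rw [hr, hmod]; exact norm_pos_iff.mpr hm₀
  obtain ⟨M, hM⟩ : ∃ M : ℝ, ∀ m, ‖β m‖ ≤ M := by
    refine ⟨∑ i ∈ Finset.Ico (0 : ℤ) q, ‖β i‖, fun m => ?_⟩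
    rw [← hmod m]
    refine Finset.single_le_sum (f := fun i => ‖β i‖) (fun _ _ => norm_nonneg _) ?_
    exact Finset.mem_Ico.mpr ⟨Int.emod_nonneg _ hq.ne', Int.emod_lt_of_pos _ hq⟩
  have hM0 : 0 ≤ M := (norm_nonneg _).trans (hM 0)
  set M' : ℝ := (|x| + 6) * M with hM'
  -- The squared norms of the truncations grow linearly, while those of the defects stay bounded.
  have key : ∀ n : ℕ, n * ‖β r‖ ^ 2 ≤ K ^ 2 * (4 * M' ^ 2) := by
    intro n
    set u : ellTwo := ∑ i ∈ Finset.Ico (0 : ℤ) (q * n), lp.single 2 i (β i) with hu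
    have hum : ∀ m : ℤ, u m = if 0 ≤ m ∧ m < q * n then β m else 0 :=
      truncation_apply β (q * n)
    have hub : ∀ m, ‖u m‖ ≤ M := fun m => by
      rw [hum]
      split_ifs
      · exact hM m
      · simpa using hM0
    have hlower : n * ‖β r‖ ^ 2 ≤ ‖u‖ ^ 2 := by
      have h1 := lp.norm_sum_single (p := 2) (by norm_num) β (Finset.Ico (0 : ℤ) (q * n))
      rw [← hu] at h1
      simp only [ENNReal.toReal_ofNat, Real.rpow_ofNat] at h1
      rw [h1]
      have hinj : Function.Injective fun l : ℕ => r + q * (l : ℤ) := by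
        intro a b hab
        have : (q : ℤ) * a = q * b := by simpa using hab
        exact_mod_cast mul_left_cancel₀ hq.ne' this
      have hsub : (Finset.range n).map ⟨_, hinj⟩ ⊆ Finset.Ico (0 : ℤ) (q * n) := by
        intro m hm
        obtain ⟨l, hl, rfl⟩ := Finset.mem_map.mp hm
        have hl' : (l : ℤ) + 1 ≤ n := by exact_mod_cast Finset.mem_range.mp hl
        simp only [Function.Embedding.coeFn_mk, Finset.mem_Ico]
        constructor
        · positivity
        · nlinarith
      refine le_trans (le_of_eq ?_)
        (Finset.sum_le_sum_of_subset_of_nonneg hsub fun _ _ _ => by positivity)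
      simp [Finset.sum_map, hper]
    have hdefect : ‖(x : ℂ) • u - H Φ θ u‖ ^ 2 ≤ 4 * M' ^ 2 := by
      have happ : ∀ m : ℤ, ((x : ℂ) • u - H Φ θ u) m
          = x * u m - (c (θ + m * (Φ / (2 * Real.pi))) * u (m + 1)
            + (starRingEnd ℂ) (c (θ + (m - 1) * (Φ / (2 * Real.pi)))) * u (m - 1)
            + (v (θ + m * (Φ / (2 * Real.pi))) : ℂ) * u m) := fun m => by
        rw [← H_apply]; rfl
      have hs := norm_sq_le_of_support ((x : ℂ) • u - H Φ θ u)
        {-1, 0, (q : ℤ) * n - 1, (q : ℤ) * n} (M := M') (fun m hm => by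
          simp only [Finset.mem_insert, Finset.mem_singleton, not_or] at hm
          rw [happ, hum, hum, hum]
          by_cases hin : 0 ≤ m ∧ m < q * n
          · rw [if_pos hin, if_pos (by omega), if_pos (by omega), hβ, sub_self]
          · rw [if_neg hin, if_neg (by omega), if_neg (by omega)]
            simp) (fun m => by
          rw [happ]
          have e1 : ‖c (θ + m * (Φ / (2 * Real.pi))) * u (m + 1)‖ ≤ 2 * M := by
            rw [norm_mul]
            exact mul_le_mul (norm_c_le _) (hub _) (norm_nonneg _) zero_le_two
          have e2 : ‖(starRingEnd ℂ) (c (θ + (m - 1) * (Φ / (2 * Real.pi)))) * u (m - 1)‖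
              ≤ 2 * M := by
            rw [norm_mul, RCLike.norm_conj]
            exact mul_le_mul (norm_c_le _) (hub _) (norm_nonneg _) zero_le_two
          have e3 : ‖(v (θ + m * (Φ / (2 * Real.pi))) : ℂ) * u m‖ ≤ 2 * M := by
            rw [norm_mul]
            exact mul_le_mul (norm_v_le _) (hub _) (norm_nonneg _) zero_le_two
          have e4 : ‖(x : ℂ) * u m‖ ≤ |x| * M := by
            rw [norm_mul, Complex.norm_real, Real.norm_eq_abs]
            exact mul_le_mul_of_nonneg_left (hub _) (abs_nonneg _)
          refine (norm_sub_le _ _).trans ?_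
          have e5 := (norm_add₃_le (a := c (θ + m * (Φ / (2 * Real.pi))) * u (m + 1))
            (b := (starRingEnd ℂ) (c (θ + (m - 1) * (Φ / (2 * Real.pi)))) * u (m - 1))
            (c := (v (θ + m * (Φ / (2 * Real.pi))) : ℂ) * u m))
          rw [hM']
          linarith)
      refine hs.trans (mul_le_mul_of_nonneg_right ?_ (by positivity))
      exact_mod_cast Finset.card_le_four
    calc n * ‖β r‖ ^ 2 ≤ ‖u‖ ^ 2 := hlower
      _ ≤ (K * ‖(x : ℂ) • u - H Φ θ u‖) ^ 2 := pow_le_pow_left₀ (norm_nonneg _) (hK u) 2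
      _ = K ^ 2 * ‖(x : ℂ) • u - H Φ θ u‖ ^ 2 := mul_pow _ _ _
      _ ≤ _ := mul_le_mul_of_nonneg_left hdefect (by positivity)
  obtain ⟨n, hn⟩ := exists_nat_gt (K ^ 2 * (4 * M' ^ 2) / ‖β r‖ ^ 2)
  rw [div_lt_iff₀ (by positivity)] at hn
  exact absurd (key n) (not_le.mpr hn)

theorem bandFunction_mem_spectrum {q : ℕ} [NeZero q] {Φ : ℝ}
    (hω : IsPrimitiveRoot (phase (Φ / (2 * Real.pi))) q) (j : Fin q) (θ k : ℝ) :
    bandFunction Φ q j θ k ∈ spectrum ℝ (H Φ θ) := by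
  obtain ⟨w, hw, hwE⟩ := exists_eigenvector Φ j θ k
  set y := Complex.exp (Complex.I * k) with hy
  have hy0 : y ≠ 0 := Complex.exp_ne_zero _
  have hyn : ‖y‖ = 1 := by
    rw [hy, mul_comm]
    exact Complex.norm_exp_ofReal_mul_I k
  refine mem_spectrum_of_bloch_wave (q := q) (β := fun m => y ^ m * w (residue q m)) ?_ ?_ ?_
  · intro m
    have h1 := c_add_int_mul θ (Φ / (2 * Real.pi)) m
    have h2 := conj_c_add_int_mul θ (Φ / (2 * Real.pi)) (m - 1)
    have h3 := v_add_int_mul θ (Φ / (2 * Real.pi)) m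
    push_cast at h2
    have h := congrFun hwE (residue q m)
    rw [floquet_eq_fibreMatrix, fibreMatrix_mulVec_apply hω.pow_eq_one, ← hy, Pi.smul_apply,
      smul_eq_mul] at h
    rw [h1, h2, h3, zpow_add_one₀ hy0, zpow_sub_one₀ hy0]
    linear_combination y ^ m * h
  · intro m l
    simp [residue_add_mul, hyn]
  · obtain ⟨i, hi⟩ := Function.ne_iff.mp hw
    refine ⟨(i : ℕ), mul_ne_zero (zpow_ne_zero _ hy0) ?_⟩
    rwa [residue_natCast]

theorem spec_eq_iUnion_band {q : ℕ} [NeZero q] {Φ : ℝ}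
    (hω : IsPrimitiveRoot (phase (Φ / (2 * Real.pi))) q) :
    spec Φ = ⋃ j : Fin q, band Φ q j := by
  ext x
  simp only [spec, band, Set.mem_iUnion, Set.mem_ofPred_eq]
  constructor
  · rintro ⟨θ, hx⟩
    obtain ⟨j, k, h⟩ := spectrum_H_subset hω hx
    exact ⟨j, θ, k, h⟩
  · rintro ⟨j, θ, k, rfl⟩
    exact ⟨θ, bandFunction_mem_spectrum hω j θ k⟩

end Weyl

/-! ### Shape and order of the bands -/

section Bands

theorem continuous_c : Continuous c := by
  unfold c
  fun_prop

theorem continuous_v : Continuous v := by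
  unfold v
  fun_prop

theorem continuous_floquet (Φ : ℝ) (q : ℕ) :
    Continuous fun x : ℝ × ℝ => floquet Φ q x.1 x.2 := by
  refine continuous_matrix fun i j => ?_
  simp only [floquet, of_apply]
  have hc := continuous_c
  have hv := continuous_v
  refine ((continuous_if_const _ (fun _ => ?_) fun _ => continuous_const).add
    (continuous_if_const _ (fun _ => ?_) fun _ => continuous_const)).add
    (continuous_if_const _ (fun _ => ?_) fun _ => continuous_const)
  · fun_prop
  · exact (by fun_prop : Continuous fun x : ℝ × ℝ => Complex.exp (-(Complex.I * x.2))).mul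
      (Complex.continuous_conj.comp (by fun_prop))
  · exact Complex.continuous_ofReal.comp (by fun_prop)

theorem continuous_bandFunction (Φ : ℝ) {q : ℕ} (j : Fin q) :
    Continuous fun x : ℝ × ℝ => bandFunction Φ q j x.1 x.2 :=
  continuous_eigenvalues₀ (fun x : ℝ × ℝ => floquet_isHermitian Φ q x.1 x.2)
    (continuous_floquet Φ q) _

theorem bandFunction_mono (Φ : ℝ) {q : ℕ} {i j : Fin q} (hij : i ≤ j) (θ k : ℝ) :
    bandFunction Φ q i θ k ≤ bandFunction Φ q j θ k := by
  refine IsHermitian.eigenvalues₀_antitone _ ?_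
  exact (Fin.rev_le_rev.mpr hij : j.rev ≤ i.rev)

theorem chambersFunction_add_int (q : ℕ) (θ k : ℝ) (m l : ℤ) :
    chambersFunction q (θ + m) (k + l * (2 * Real.pi)) = chambersFunction q θ k := by
  have h1 : (q : ℝ) * (k + l * (2 * Real.pi)) = q * k + ((q * l : ℤ) : ℝ) * (2 * Real.pi) := by
    push_cast; ring
  have h2 : 2 * Real.pi * ((q : ℝ) * (θ + m))
      = 2 * Real.pi * (q * θ) + ((q * m : ℤ) : ℝ) * (2 * Real.pi) := by
    push_cast; ring
  have h3 : (q : ℝ) * (k + l * (2 * Real.pi)) - 2 * Real.pi * ((q : ℝ) * (θ + m))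
      = (q * k - 2 * Real.pi * (q * θ)) + ((q * l - q * m : ℤ) : ℝ) * (2 * Real.pi) := by
    push_cast; ring
  rw [chambersFunction, h3, h1, h2, Real.cos_add_int_mul_two_pi, Real.cos_add_int_mul_two_pi,
    Real.cos_add_int_mul_two_pi, chambersFunction]

theorem band_eq_range (Φ : ℝ) {q : ℕ} (j : Fin q) :
    band Φ q j = Set.range fun x : ℝ × ℝ => bandFunction Φ q j x.1 x.2 := by
  ext x
  simp [band]

/-- A value shared by two band functions at the same point is a double root of the characteristic
polynomial. -/
theorem derivative_eval_eq_zero_of_bandFunction_eq {Φ : ℝ} {q : ℕ} {i j : Fin q} (hij : i ≠ j)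
    {θ k y : ℝ}
    (hi : bandFunction Φ q i θ k = y) (hj : bandFunction Φ q j θ k = y) :
    (derivative (floquet Φ q θ k).charpoly).eval (y : ℂ) = 0 := by
  rw [charpoly_floquet_eq_prod, ← Finset.mul_prod_erase _ _ (Finset.mem_univ i),
    ← Finset.mul_prod_erase _ _ (Finset.mem_erase.mpr ⟨hij.symm, Finset.mem_univ j⟩), hi, hj]
  simp [derivative_mul]

theorem isConnected_band (Φ : ℝ) {q : ℕ} (j : Fin q) : IsConnected (band Φ q j) := by
  rw [band_eq_range]
  exact isConnected_range (continuous_bandFunction Φ j)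

variable {q : ℕ} [NeZero q] {Φ : ℝ}

/-- A band is the image of a period cell. -/
theorem isCompact_band (hω : IsPrimitiveRoot (phase (Φ / (2 * Real.pi))) q) (j : Fin q) :
    IsCompact (band Φ q j) := by
  have h : band Φ q j = (fun x : ℝ × ℝ => bandFunction Φ q j x.1 x.2) ''
      (Set.Icc 0 1 ×ˢ Set.Icc 0 (2 * Real.pi)) := by
    rw [band_eq_range]
    refine (Set.image_subset_range _ _).antisymm' ?_
    rintro _ ⟨⟨θ, k⟩, rfl⟩
    have hpi := Real.two_pi_pos
    refine ⟨(Int.fract θ, Int.fract (k / (2 * Real.pi)) * (2 * Real.pi)),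
      ⟨⟨Int.fract_nonneg _, (Int.fract_lt_one _).le⟩,
        mul_nonneg (Int.fract_nonneg _) hpi.le,
        mul_le_of_le_one_left hpi.le (Int.fract_lt_one _).le⟩, ?_⟩
    refine bandFunction_eq_of_chambersFunction_eq hω j ?_
    rw [← chambersFunction_add_int q (Int.fract θ) _ ⌊θ⌋ ⌊k / (2 * Real.pi)⌋, Int.fract_add_floor,
      ← add_mul, Int.fract_add_floor, div_mul_cancel₀ _ hpi.ne']
  rw [h]
  exact (isCompact_Icc.prod isCompact_Icc).image (continuous_bandFunction Φ j)

theorem derivative_charpoly_floquet_ne_zero (θ k : ℝ) :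
    derivative (floquet Φ q θ k).charpoly ≠ 0 := by
  intro h
  have h1 := derivative_eq_zero.mp h
  rw [charpoly_natDegree_eq_dim, Fintype.card_fin] at h1
  exact NeZero.ne q h1

/-- Distinct bands overlap in at most a point: a common interior point would be a double root, and
the derivative of `P` has finitely many roots. -/
theorem bandFunction_le_of_lt (hω : IsPrimitiveRoot (phase (Φ / (2 * Real.pi))) q) {i j : Fin q}
    (hij : i < j) (x x' : ℝ × ℝ) :
    bandFunction Φ q i x.1 x.2 ≤ bandFunction Φ q j x'.1 x'.2 := by
  by_contra! hlt
  have hroot : ∀ y ∈ Set.Ioo (bandFunction Φ q j x'.1 x'.2) (bandFunction Φ q i x.1 x.2),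
      (derivative (chambersPolynomial q (phase (Φ / (2 * Real.pi))))).eval (y : ℂ) = 0 := by
    rintro y ⟨hy, hy'⟩
    obtain ⟨a, ha⟩ := mem_range_of_exists_le_of_exists_ge (continuous_bandFunction Φ i)
      ⟨x', (bandFunction_mono Φ hij.le _ _).trans hy.le⟩ ⟨x, hy'.le⟩
    obtain ⟨b, hb⟩ := mem_range_of_exists_le_of_exists_ge (continuous_bandFunction Φ j)
      ⟨x', hy.le⟩ ⟨x, hy'.le.trans (bandFunction_mono Φ hij.le _ _)⟩
    simp only at ha hb
    have hab : chambersFunction q b.1 b.2 = chambersFunction q a.1 a.2 := by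
      have h1 := eval_chambersPolynomial_bandFunction hω i a.1 a.2
      have h2 := eval_chambersPolynomial_bandFunction hω j b.1 b.2
      rw [ha] at h1
      rw [hb, h1] at h2
      exact_mod_cast h2.symm
    have hib : bandFunction Φ q i b.1 b.2 = y :=
      (bandFunction_eq_of_chambersFunction_eq hω i hab).trans ha
    have h := derivative_eval_eq_zero_of_bandFunction_eq hij.ne hib hb
    rwa [charpoly_floquet hω, derivative_sub, derivative_C, sub_zero] at h
  have hinf : Set.Infinite {w : ℂ | IsRoot
      (derivative (chambersPolynomial q (phase (Φ / (2 * Real.pi))))) w} := by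
    refine Set.Infinite.mono ?_ ((Set.Ioo_infinite hlt).image Complex.ofReal_injective.injOn)
    rintro _ ⟨y, hy, rfl⟩
    exact hroot y hy
  refine derivative_charpoly_floquet_ne_zero (Φ := Φ) (q := q) 0 0 ?_
  rw [charpoly_floquet hω, derivative_sub, derivative_C, sub_zero]
  exact eq_zero_of_infinite_isRoot _ hinf

/-- The band functions are not constant: at these two points `g` takes the values `4 - 2 (-1)^q` and
`-4 - 2 (-1)^q`. -/
theorem exists_bandFunction_ne (hω : IsPrimitiveRoot (phase (Φ / (2 * Real.pi))) q) (j : Fin q) :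
    bandFunction Φ q j 0 0 ≠ bandFunction Φ q j (1 / (2 * q)) (Real.pi / q) := by
  intro h
  have h1 := eval_chambersPolynomial_bandFunction hω j 0 0
  have h2 := eval_chambersPolynomial_bandFunction hω j (1 / (2 * q)) (Real.pi / q)
  rw [h, h2] at h1
  have h3 : chambersFunction q (1 / (2 * q)) (Real.pi / q) = chambersFunction q 0 0 := by
    exact_mod_cast h1
  have hq : (q : ℝ) ≠ 0 := Nat.cast_ne_zero.mpr (NeZero.ne q)
  have e1 : (q : ℝ) * (Real.pi / q) = Real.pi := by field_simp
  have e2 : 2 * Real.pi * ((q : ℝ) * (1 / (2 * q))) = Real.pi := by field_simp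
  simp only [chambersFunction, e1, e2, mul_zero, sub_self, Real.cos_pi, Real.cos_zero] at h3
  linarith

end Bands

/-! ### The measure of the spectrum -/

section Measure

/-- The slack is `|1 - s e^{iX} - s e^{iY}|²`, where `s = (-1)^q`, `X = qk` and `Y = 2πqθ`. -/
theorem chambersFunction_le_three (q : ℕ) (θ k : ℝ) : (-1) ^ q * chambersFunction q θ k ≤ 3 := by
  set X := (q : ℝ) * k
  set Y := 2 * Real.pi * ((q : ℝ) * θ)
  have hs : ((-1 : ℝ) ^ q) * (-1) ^ q = 1 := by rw [← mul_pow]; simp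
  set s : ℝ := (-1) ^ q
  have h : 3 - s * (2 * Real.cos X + 2 * Real.cos Y - s * (2 * Real.cos (X - Y)))
      = (1 - s * Real.cos X - s * Real.cos Y) ^ 2 + (Real.sin X + Real.sin Y) ^ 2 := by
    rw [Real.cos_sub]
    have hX := Real.sin_sq_add_cos_sq X
    have hY := Real.sin_sq_add_cos_sq Y
    linear_combination (2 * (Real.cos X * Real.cos Y + Real.sin X * Real.sin Y)
      - (Real.cos X + Real.cos Y) ^ 2) * hs - hX - hY
  rw [chambersFunction]
  nlinarith [sq_nonneg (1 - s * Real.cos X - s * Real.cos Y),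
    sq_nonneg (Real.sin X + Real.sin Y)]

theorem neg_six_le_chambersFunction (q : ℕ) (θ k : ℝ) :
    -6 ≤ (-1) ^ q * chambersFunction q θ k := by
  rw [chambersFunction]
  set X := (q : ℝ) * k
  set Y := 2 * Real.pi * ((q : ℝ) * θ)
  have h1 := Real.abs_cos_le_one X
  have h2 := Real.abs_cos_le_one Y
  have h3 := Real.abs_cos_le_one (X - Y)
  rw [abs_le] at h1 h2 h3
  rcases neg_one_pow_eq_or ℝ q with h | h <;> rw [h] <;> linarith

/-- The phase `θ` for which the edge closing the cycle has weight `c (1/2 + δ)`; it vanishes at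
`δ = 0`. -/
noncomputable def cutPhase (Φ : ℝ) (q : ℕ) (δ : ℝ) : ℝ :=
  1 / 2 + δ - (q - 1) * (Φ / (2 * Real.pi))

variable {q : ℕ} [NeZero q] {Φ : ℝ}

theorem chambersFunction_cutPhase {p : ℤ} (hΦ : Φ / (2 * Real.pi) = (p : ℝ) / (q : ℝ))
    (δ X : ℝ) : chambersFunction q (cutPhase Φ q δ) (X / q)
      = 2 * Real.cos X + (-1) ^ q * (2 * Real.cos (2 * Real.pi * (q * δ)))
        - 2 * Real.cos (X - 2 * Real.pi * (q * δ)) := by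
  have hq : (q : ℝ) ≠ 0 := Nat.cast_ne_zero.mpr (NeZero.ne q)
  have h1 : (q : ℝ) * (X / q) = X := by field_simp
  have h2 : 2 * Real.pi * (q * cutPhase Φ q δ) = 2 * Real.pi * (q * δ) + (q : ℕ) * Real.pi
      - (((q - 1) * p : ℤ) : ℝ) * (2 * Real.pi) := by
    rw [cutPhase, hΦ]
    push_cast
    field_simp
    ring
  have h3 : X - (2 * Real.pi * (q * δ) + (q : ℕ) * Real.pi
        - (((q - 1) * p : ℤ) : ℝ) * (2 * Real.pi))
      = (X - 2 * Real.pi * (q * δ) - (q : ℕ) * Real.pi)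
        + (((q - 1) * p : ℤ) : ℝ) * (2 * Real.pi) := by ring
  have hs : ((-1 : ℝ) ^ q) * (-1) ^ q = 1 := by rw [← mul_pow]; simp
  rw [chambersFunction, h1, h2, h3, Real.cos_add_int_mul_two_pi, Real.cos_sub_int_mul_two_pi,
    Real.cos_add_nat_mul_pi, Real.cos_sub_nat_mul_pi]
  linear_combination (-2 * Real.cos (X - 2 * Real.pi * (q * δ))) * hs

/-- The two cut phases together attain every value of `g`: up to the sign `(-1)^q` the first attains
`[-6, 2]` and the second `[-1, 3]`. -/
theorem exists_chambersFunction_cutPhase_eq {p : ℤ}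
    (hΦ : Φ / (2 * Real.pi) = (p : ℝ) / (q : ℝ)) (θ k : ℝ) :
    ∃ k', chambersFunction q (cutPhase Φ q (1 / (2 * q))) k' = chambersFunction q θ k
      ∨ chambersFunction q (cutPhase Φ q (1 / (6 * q))) k' = chambersFunction q θ k := by
  have hq : (q : ℝ) ≠ 0 := Nat.cast_ne_zero.mpr (NeZero.ne q)
  have hs : ((-1 : ℝ) ^ q) * (-1) ^ q = 1 := by rw [← mul_pow]; simp
  have hs' := neg_one_pow_eq_or ℝ q
  have hlow := neg_six_le_chambersFunction q θ k
  have hhigh := chambersFunction_le_three q θ k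
  set g := chambersFunction q θ k
  rcases le_or_gt ((-1) ^ q * g) 2 with h | h
  · refine ⟨Real.arccos ((g + 2 * (-1) ^ q) / 4) / q, Or.inl ?_⟩
    rw [chambersFunction_cutPhase hΦ]
    have e : 2 * Real.pi * ((q : ℝ) * (1 / (2 * q))) = Real.pi := by field_simp
    rw [e, Real.cos_sub_pi, Real.cos_pi, Real.cos_arccos]
    · ring
    · rcases hs' with h' | h' <;> rw [h'] at hlow h ⊢ <;> linarith
    · rcases hs' with h' | h' <;> rw [h'] at hlow h ⊢ <;> linarith
  · refine ⟨(Real.arccos ((g - (-1) ^ q) / 2) - Real.pi / 3) / q, Or.inr ?_⟩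
    rw [chambersFunction_cutPhase hΦ]
    have e : 2 * Real.pi * ((q : ℝ) * (1 / (6 * q))) = Real.pi / 3 := by field_simp; norm_num
    have hc : Real.cos (Real.arccos ((g - (-1) ^ q) / 2)) = (g - (-1) ^ q) / 2 := by
      apply Real.cos_arccos
      · rcases hs' with h' | h' <;> rw [h'] at hhigh h ⊢ <;> linarith
      · rcases hs' with h' | h' <;> rw [h'] at hhigh h ⊢ <;> linarith
    set t := Real.arccos ((g - (-1) ^ q) / 2)
    have e2 : 2 * Real.cos (t - Real.pi / 3) - 2 * Real.cos (t - Real.pi / 3 - Real.pi / 3)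
        = 2 * Real.cos t := by
      have := Real.cos_add (t - Real.pi / 3) (Real.pi / 3)
      have h2 := Real.cos_sub (t - Real.pi / 3) (Real.pi / 3)
      rw [sub_add_cancel] at this
      rw [this, h2, Real.cos_pi_div_three]
      ring
    rw [e, Real.cos_pi_div_three]
    linear_combination e2 + 2 * hc

/-- The strict inequality `|sin x| < |x|` used here is what makes the measure bound strict. -/
theorem norm_c_half_add_lt {δ : ℝ} (hδ : 0 < δ) : ‖c (1 / 2 + δ)‖ < 2 * Real.pi * δ := by
  have h1 : c (1 / 2 + δ) = -(Complex.exp (Complex.I * ((-(2 * Real.pi * δ) : ℝ) : ℂ)) - 1) := by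
    have h2 : phase (1 / 2) = -1 := by
      rw [phase, ← Complex.exp_neg_pi_mul_I]
      congr 1
      push_cast
      ring
    rw [c_eq_one_add_phase, phase_add, h2, phase]
    have : (-2 * (Real.pi : ℂ) * Complex.I * δ) = Complex.I * ((-(2 * Real.pi * δ) : ℝ) : ℂ) := by
      push_cast; ring
    rw [this]
    ring
  have hpos : 0 < Real.pi * δ := mul_pos Real.pi_pos hδ
  rw [h1, norm_neg, Complex.norm_exp_I_mul_ofReal_sub_one, norm_mul, Real.norm_two,
    Real.norm_eq_abs, show -(2 * Real.pi * δ) / 2 = -(Real.pi * δ) by ring, Real.sin_neg, abs_neg]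
  have h3 : |Real.sin (Real.pi * δ)| < Real.pi * δ := by
    simpa only [abs_of_pos hpos] using Real.abs_sin_lt_abs hpos.ne'
  linarith

/-- The site `q - 1`. -/
def lastIndex (q : ℕ) [NeZero q] : Fin q := ⟨q - 1, Nat.sub_lt (Nat.pos_of_neZero q) one_pos⟩

/-- The gauge transformation `diag(e^{iki})` concentrates the dependence on `k` in the edge between
the sites `q - 1` and `0`. -/
theorem gauge_floquet (θ k : ℝ) (i j : Fin q) :
    Complex.exp (Complex.I * k) ^ (i : ℕ) * floquet Φ q θ k i j
        * (Complex.exp (Complex.I * k) ^ (j : ℕ))⁻¹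
      = (floquet Φ q θ 0
        + (single (lastIndex q) 0 ((Complex.exp (Complex.I * k) ^ q - 1)
            * c (θ + (q - 1) * (Φ / (2 * Real.pi))))
          + single 0 (lastIndex q) ((starRingEnd ℂ) ((Complex.exp (Complex.I * k) ^ q - 1)
            * c (θ + (q - 1) * (Φ / (2 * Real.pi)))))) : Matrix (Fin q) (Fin q) ℂ) i j := by
  set y := Complex.exp (Complex.I * k) with hy
  have hy0 : y ≠ 0 := Complex.exp_ne_zero _
  have hconj : (starRingEnd ℂ) y = y⁻¹ := by
    rw [hy, ← Complex.exp_conj, ← Complex.exp_neg]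
    simp
  have hq := Nat.pos_of_neZero q
  have hq1 : ((q : ℝ) - 1) = ((q - 1 : ℕ) : ℝ) := by
    rw [Nat.cast_sub hq, Nat.cast_one]
  -- Multiplying by `y ^ (i - j)` cancels the factor `y` on every edge except the one that closes
  -- the cycle, where the powers add up to `y ^ q`.
  have hop : ∀ (i j : Fin q) (a : ℂ), (if ((i : ℕ) + 1) % q = j then y * a else 0)
        * (y ^ (i : ℕ) * (y ^ (j : ℕ))⁻¹)
      = (if ((i : ℕ) + 1) % q = j then a else 0)
        + (if lastIndex q = i ∧ 0 = j then (y ^ q - 1) * a else 0) := by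
    intro i j a
    by_cases hi : (i : ℕ) + 1 = q
    · have hlast : lastIndex q = i := by
        ext; simp only [lastIndex]; omega
      have h0 : ((0 : ℕ) = j) ↔ (0 : Fin q) = j := by rw [Fin.ext_iff]; simp
      simp only [hi, Nat.mod_self, h0, hlast, true_and]
      split_ifs with hj
      · subst hj
        have : y ^ q = y * y ^ (i : ℕ) := by rw [← pow_succ', hi]
        rw [this]
        simp
        ring
      · simp
    · have hlast : lastIndex q ≠ i := by
        intro h
        apply hi
        rw [← h]
        simp only [lastIndex]
        omega
      rw [Nat.mod_eq_of_lt (by omega)]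
      simp only [hlast, false_and, if_false, add_zero]
      split_ifs with hj
      · rw [← hj, pow_succ]
        field_simp
      · simp
  have hop' := congrArg (starRingEnd ℂ) (hop j i (c (θ + (j : ℕ) * (Φ / (2 * Real.pi)))))
  simp only [apply_ite (starRingEnd ℂ), map_mul, map_add, map_zero, map_pow, map_inv₀, hconj,
    map_sub, map_one, inv_pow, inv_inv] at hop'
  have hop1 := hop i j (c (θ + (i : ℕ) * (Φ / (2 * Real.pi))))
  have hd : y ^ (i : ℕ) * (if i = j then (v (θ + (i : ℕ) * (Φ / (2 * Real.pi))) : ℂ) else 0)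
        * (y ^ (j : ℕ))⁻¹
      = if i = j then (v (θ + (i : ℕ) * (Φ / (2 * Real.pi))) : ℂ) else 0 := by
    split_ifs with h
    · rw [h]; field_simp
    · simp
  have e1 : (if lastIndex q = i ∧ 0 = j then (y ^ q - 1) * c (θ + (i : ℕ) * (Φ / (2 * Real.pi)))
      else 0)
      = single (lastIndex q) 0 ((y ^ q - 1) * c (θ + (q - 1) * (Φ / (2 * Real.pi)))) i j := by
    rw [single_apply]
    split_ifs with h
    · rw [← h.1, hq1]; rfl
    · rfl
  have e2 : (if lastIndex q = j ∧ 0 = i then ((y ^ q)⁻¹ - 1)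
        * (starRingEnd ℂ) (c (θ + (j : ℕ) * (Φ / (2 * Real.pi)))) else 0)
      = single 0 (lastIndex q) ((starRingEnd ℂ)
        ((y ^ q - 1) * c (θ + (q - 1) * (Φ / (2 * Real.pi))))) i j := by
    rw [single_apply, if_congr and_comm rfl rfl]
    split_ifs with h
    · rw [← h.2, hq1, map_mul, map_sub, map_pow, hconj, map_one, inv_pow]; rfl
    · rfl
  rw [Matrix.add_apply, Matrix.add_apply, ← e1, ← e2]
  simp only [floquet, of_apply, Complex.exp_neg, ← hy, Complex.ofReal_zero, mul_zero,
    Complex.exp_zero, inv_one, one_mul]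
  linear_combination hop1 + hop' + hd

/-- The Floquet fibre with the edge between the sites `q - 1` and `0` removed, in the gauge in which
it does not depend on `k`. For `q = 1` this edge is a loop. -/
noncomputable def cutFloquet (Φ : ℝ) (q : ℕ) [NeZero q] (θ : ℝ) : Matrix (Fin q) (Fin q) ℂ :=
  floquet Φ q θ 0 - (single (lastIndex q) 0 (c (θ + (q - 1) * (Φ / (2 * Real.pi))))
    + single 0 (lastIndex q) ((starRingEnd ℂ) (c (θ + (q - 1) * (Φ / (2 * Real.pi))))))

/-- The sum of the coordinate projections at the sites `0` and `q - 1`; it has trace `2` also for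
`q = 1`. -/
def endpointMatrix (q : ℕ) [NeZero q] : Matrix (Fin q) (Fin q) ℂ :=
  single 0 0 1 + single (lastIndex q) (lastIndex q) 1

theorem isHermitian_single_add_single {n : Type*} [DecidableEq n] (a b : n) (η : ℂ) :
    (single a b η + single b a ((starRingEnd ℂ) η)).IsHermitian := by
  simp [IsHermitian, conjTranspose_add, conjTranspose_single, add_comm]

theorem isHermitian_cutFloquet (θ : ℝ) : (cutFloquet Φ q θ).IsHermitian :=
  (floquet_isHermitian Φ q θ 0).sub (isHermitian_single_add_single _ _ _)

theorem isHermitian_cutFloquet_add (θ r : ℝ) :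
    (cutFloquet Φ q θ + (r : ℂ) • endpointMatrix q).IsHermitian := by
  refine (isHermitian_cutFloquet θ).add ?_
  simp [endpointMatrix, IsHermitian, conjTranspose_add]

theorem re_quadraticForm_endpointMatrix (r : ℝ) (x : Fin q → ℂ) :
    (star x ⬝ᵥ ((r : ℂ) • endpointMatrix q) *ᵥ x).re
      = r * (‖x 0‖ ^ 2 + ‖x (lastIndex q)‖ ^ 2) := by
  have h : ∀ w : ℂ, (w * (starRingEnd ℂ) w).re = ‖w‖ ^ 2 := fun w => by
    rw [Complex.mul_conj, Complex.ofReal_re, Complex.normSq_eq_norm_sq]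
  rw [smul_mulVec, dotProduct_smul, smul_eq_mul, Complex.re_ofReal_mul, endpointMatrix, add_mulVec,
    dotProduct_add, Complex.add_re]
  simp [single_mulVec_eq, -Complex.mul_re, h]

theorem abs_re_quadraticForm_single_add_single_le {n : Type*} [Fintype n] [DecidableEq n]
    (a b : n) (η : ℂ) (x : n → ℂ) :
    |(star x ⬝ᵥ (single a b η + single b a ((starRingEnd ℂ) η)) *ᵥ x).re|
      ≤ ‖η‖ * (‖x b‖ ^ 2 + ‖x a‖ ^ 2) := by
  refine (Complex.abs_re_le_norm _).trans ?_
  rw [add_mulVec, dotProduct_add]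
  refine (norm_add_le _ _).trans ?_
  simp only [single_mulVec_eq, dotProduct_smul, dotProduct_single, smul_eq_mul, mul_one,
    norm_mul, Pi.star_apply, norm_star, RCLike.norm_conj]
  nlinarith [norm_nonneg η, mul_nonneg (norm_nonneg η) (sq_nonneg (‖x a‖ - ‖x b‖))]

/-- At a fixed phase the values of the band functions lie in intervals of total length four times
the modulus of the weight of the closing edge. -/
theorem exists_Icc_bandFunction (Φ : ℝ) (q : ℕ) [NeZero q] (θ : ℝ) :
    ∃ l u : Fin q → ℝ, (∀ j k, bandFunction Φ q j θ k ∈ Set.Icc (l j) (u j)) ∧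
      ∑ j, (u j - l j) = 4 * ‖c (θ + (q - 1) * (Φ / (2 * Real.pi)))‖ := by
  set c₀ := c (θ + (q - 1) * (Φ / (2 * Real.pi))) with hc₀
  have hl := isHermitian_cutFloquet_add (Φ := Φ) (q := q) θ (-‖c₀‖)
  have hu := isHermitian_cutFloquet_add (Φ := Φ) (q := q) θ ‖c₀‖
  let e : Fin q ≃ Fin (Fintype.card (Fin q)) :=
    Fin.revPerm.trans (finCongr (Fintype.card_fin q).symm)
  refine ⟨fun j => hl.eigenvalues₀ (e j), fun j => hu.eigenvalues₀ (e j), fun j k => ?_, ?_⟩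
  · set y := Complex.exp (Complex.I * k) with hy
    have hy0 : y ≠ 0 := Complex.exp_ne_zero _
    have hyn : ‖y‖ = 1 := by
      rw [hy, mul_comm]
      exact Complex.norm_exp_ofReal_mul_I k
    set A : Matrix (Fin q) (Fin q) ℂ := cutFloquet Φ q θ + (single (lastIndex q) 0 (y ^ q * c₀)
      + single 0 (lastIndex q) ((starRingEnd ℂ) (y ^ q * c₀))) with hA
    have hAh : A.IsHermitian :=
      (isHermitian_cutFloquet θ).add (isHermitian_single_add_single _ _ _)
    have hconj : A = diagonal (fun i : Fin q => y ^ (i : ℕ)) * floquet Φ q θ k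
        * diagonal (fun i : Fin q => (y ^ (i : ℕ))⁻¹) := by
      ext i j
      rw [mul_diagonal, diagonal_mul, gauge_floquet, hA, cutFloquet, ← hc₀, ← hy]
      simp only [Matrix.add_apply, Matrix.sub_apply, single_apply, map_mul, map_sub,
        sub_mul, one_mul]
      split_ifs <;> ring
    have hchar : (floquet Φ q θ k).charpoly = A.charpoly := by
      rw [hconj, charpoly_mul_comm, ← mul_assoc, diagonal_mul_diagonal]
      simp [hy0]
    have hband : bandFunction Φ q j θ k = hAh.eigenvalues₀ (e j) :=
      congrFun (eigenvalues₀_eq_of_charpoly_eq (floquet_isHermitian Φ q θ k) hAh hchar) (e j)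
    have hquad : ∀ x : Fin q → ℂ, |(star x ⬝ᵥ (single (lastIndex q) 0 (y ^ q * c₀)
        + single 0 (lastIndex q) ((starRingEnd ℂ) (y ^ q * c₀))) *ᵥ x).re|
        ≤ ‖c₀‖ * (‖x 0‖ ^ 2 + ‖x (lastIndex q)‖ ^ 2) := fun x => by
      have := abs_re_quadraticForm_single_add_single_le (lastIndex q) 0 (y ^ q * c₀) x
      rwa [norm_mul, norm_pow, hyn, one_pow, one_mul] at this
    have hadd : ∀ (B : Matrix (Fin q) (Fin q) ℂ) (x : Fin q → ℂ),
        (star x ⬝ᵥ (cutFloquet Φ q θ + B) *ᵥ x).re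
          = (star x ⬝ᵥ cutFloquet Φ q θ *ᵥ x).re + (star x ⬝ᵥ B *ᵥ x).re := fun B x => by
      rw [add_mulVec, dotProduct_add, Complex.add_re]
    rw [hband]
    refine ⟨eigenvalues₀_le_of_forall_re_le hl hAh (fun x => ?_) _,
      eigenvalues₀_le_of_forall_re_le hAh hu (fun x => ?_) _⟩
    · rw [hA, hadd, hadd, re_quadraticForm_endpointMatrix]
      linarith [(abs_le.mp (hquad x)).1]
    · rw [hA, hadd, hadd, re_quadraticForm_endpointMatrix]
      linarith [(abs_le.mp (hquad x)).2]
  · rw [Finset.sum_sub_distrib, Equiv.sum_comp e hu.eigenvalues₀, Equiv.sum_comp e hl.eigenvalues₀,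
      sum_eigenvalues₀, sum_eigenvalues₀]
    have htr : (endpointMatrix q).trace = 2 := by
      rw [endpointMatrix, trace_add, trace_single_eq_same, trace_single_eq_same]
      norm_num
    simp only [trace_add, trace_smul, htr, Complex.add_re, smul_eq_mul, Complex.re_ofReal_mul]
    simp
    ring

theorem volume_spec_lt {p : ℤ} (hpq : IsCoprime p (q : ℤ))
    (hΦ : Φ / (2 * Real.pi) = (p : ℝ) / (q : ℝ)) :
    MeasureTheory.volume (spec Φ) < ENNReal.ofReal (16 * Real.pi / (3 * (q : ℝ))) := by
  have hω := isPrimitiveRoot_phase hpq hΦ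
  have hq : (0 : ℝ) < q := Nat.cast_pos.mpr (Nat.pos_of_neZero q)
  obtain ⟨l, u, h1, h2⟩ := exists_Icc_bandFunction Φ q (cutPhase Φ q (1 / (2 * q)))
  obtain ⟨l', u', h1', h2'⟩ := exists_Icc_bandFunction Φ q (cutPhase Φ q (1 / (6 * q)))
  have hcut : ∀ δ, cutPhase Φ q δ + (q - 1) * (Φ / (2 * Real.pi)) = 1 / 2 + δ := fun δ => by
    rw [cutPhase]; ring
  rw [hcut] at h2 h2'
  have hc := norm_c_half_add_lt (δ := 1 / (2 * q)) (by positivity)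
  have hc' := norm_c_half_add_lt (δ := 1 / (6 * q)) (by positivity)
  have hsub : spec Φ ⊆ (⋃ j, Set.Icc (l j) (u j)) ∪ ⋃ j, Set.Icc (l' j) (u' j) := by
    rw [spec_eq_iUnion_band hω]
    intro x hx
    obtain ⟨j, θ, k, rfl⟩ := Set.mem_iUnion.mp hx
    obtain ⟨k', h | h⟩ := exists_chambersFunction_cutPhase_eq hΦ θ k
    · rw [← bandFunction_eq_of_chambersFunction_eq hω j h]
      exact Or.inl (Set.mem_iUnion.mpr ⟨j, h1 j k'⟩)
    · rw [← bandFunction_eq_of_chambersFunction_eq hω j h]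
      exact Or.inr (Set.mem_iUnion.mpr ⟨j, h1' j k'⟩)
  have hvol : ∀ a b : Fin q → ℝ, (∀ j, a j ≤ b j) →
      MeasureTheory.volume (⋃ j, Set.Icc (a j) (b j)) ≤ ENNReal.ofReal (∑ j, (b j - a j)) := by
    intro a b hab
    refine (MeasureTheory.measure_iUnion_fintype_le _ _).trans (le_of_eq ?_)
    simp only [Real.volume_Icc]
    rw [ENNReal.ofReal_sum_of_nonneg fun j _ => sub_nonneg.mpr (hab j)]
  have hlu : ∀ j, l j ≤ u j := fun j => (h1 j 0).1.trans (h1 j 0).2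
  have hlu' : ∀ j, l' j ≤ u' j := fun j => (h1' j 0).1.trans (h1' j 0).2
  calc MeasureTheory.volume (spec Φ)
      ≤ ENNReal.ofReal (∑ j, (u j - l j)) + ENNReal.ofReal (∑ j, (u' j - l' j)) :=
        (MeasureTheory.measure_mono hsub).trans ((MeasureTheory.measure_union_le _ _).trans
          (add_le_add (hvol l u hlu) (hvol l' u' hlu')))
    _ = ENNReal.ofReal (4 * ‖c (1 / 2 + 1 / (2 * q))‖ + 4 * ‖c (1 / 2 + 1 / (6 * q))‖) := by
        rw [h2, h2', ENNReal.ofReal_add (by positivity) (by positivity)]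
    _ < ENNReal.ofReal (16 * Real.pi / (3 * (q : ℝ))) := by
        rw [ENNReal.ofReal_lt_ofReal_iff (by positivity)]
        have e : 16 * Real.pi / (3 * (q : ℝ))
            = 4 * (2 * Real.pi * (1 / (2 * q))) + 4 * (2 * Real.pi * (1 / (6 * q))) := by
          field_simp
          norm_num
        rw [e]
        linarith

end Measure

end HexJacobi

theorem mainTheorem7 (Φ : ℝ) (p : ℤ) (q : ℕ) (hq : 0 < q) (hpq : IsCoprime p (q : ℤ))
    (hΦ : Φ / (2 * Real.pi) = (p : ℝ) / (q : ℝ)) :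
    (∃ a b : Fin q → ℝ,
      (∀ j, a j < b j) ∧
      (∀ i j, i < j → b i ≤ a j) ∧
      (∀ j, HexJacobi.band Φ q j = Set.Icc (a j) (b j)) ∧
      HexJacobi.spec Φ = ⋃ j, Set.Icc (a j) (b j)) ∧
    MeasureTheory.volume (HexJacobi.spec Φ)
      < ENNReal.ofReal (16 * Real.pi / (3 * (q : ℝ))) := by
  have : NeZero q := ⟨hq.ne'⟩
  have hω := HexJacobi.isPrimitiveRoot_phase hpq hΦ
  have hband : ∀ j, HexJacobi.band Φ q j
      = Set.Icc (sInf (HexJacobi.band Φ q j)) (sSup (HexJacobi.band Φ q j)) := fun j =>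
    eq_Icc_of_connected_compact (HexJacobi.isConnected_band Φ j) (HexJacobi.isCompact_band hω j)
  have hne : ∀ j, (HexJacobi.band Φ q j).Nonempty := fun j =>
    (HexJacobi.isConnected_band Φ j).nonempty
  refine ⟨⟨fun j => sInf (HexJacobi.band Φ q j), fun j => sSup (HexJacobi.band Φ q j),
    fun j => ?_, fun i j hij => ?_, hband, ?_⟩, HexJacobi.volume_spec_lt hpq hΦ⟩
  · by_contra! hle
    have hsub : (HexJacobi.band Φ q j).Subsingleton := by
      rw [hband j]
      exact Set.subsingleton_Icc_of_ge hle
    exact HexJacobi.exists_bandFunction_ne hω j (hsub ⟨_, _, rfl⟩ ⟨_, _, rfl⟩)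
  · refine csSup_le (hne i) ?_
    rintro _ ⟨θ, k, rfl⟩
    refine le_csInf (hne j) ?_
    rintro _ ⟨θ', k', rfl⟩
    exact HexJacobi.bandFunction_le_of_lt hω hij (θ, k) (θ', k')
  · rw [HexJacobi.spec_eq_iUnion_band hω]
    exact Set.iUnion_congr hband
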